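/- Let $n,\ell\ge 1$ be integers, let $s_1,\dots,s_\ell\in(0,1)$ and let $p_1,\dots,p_\ell\in[1,+\infty)$. There exists a constant $C\in(0,+\infty)$, depending only on $n$, $\ell$, $s_1,\dots,s_\ell$ and $p_1,\dots,p_\ell$, such that for every (Lebesgue) measurable function $u:\mathbb{R}^n\to\mathbb{R}$ there exist measurable functions $u_1,\dots,u_\ell:\mathbb{R}^n\to\mathbb{R}$ such that $u=u_1+\dots+u_\ell$ almost everywhere on $\mathbb{R}^n$ and $$\iint_{\mathbb{R}^n\times\mathbb{R}^n}\max_{1\le i\le\ell}\frac{|u_i(x)-u_i(y)|^{p_i}}{|x-y|^{n+s_ip_i}}\,dx\,dy\;\le\;C\iint_{\mathbb{R}^n\times\mathbb{R}^n}\min_{1\le i\le\ell}\frac{|u(x)-u(y)|^{p_i}}{|x-y|^{n+s_ip_i}}\,dx\,dy,$$ where both integrals take values in $[0,+\infty]$ and $|x-y|$ is the Euclidean distance. -/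

import Mathlib

open MeasureTheory
open scoped ENNReal NNReal

/-- The integrand `|u x - u y| ^ p / |x - y| ^ (n + s p)` of the Gagliardo double integral of a
function `u` on `ℝⁿ`, with `|x - y|` the Euclidean distance, as an extended nonnegative number.
The diagonal `x = y`, where the quotient is not defined (and the real division gives `0`),
is negligible in `ℝⁿ × ℝⁿ` for `n ≥ 1`. -/
noncomputable def gagliardoIntegrand {n : ℕ} (s p : ℝ) (u : EuclideanSpace ℝ (Fin n) → ℝ)
    (x y : EuclideanSpace ℝ (Fin n)) : ℝ≥0∞ :=
  ENNReal.ofReal (|u x - u y| ^ p / ‖x - y‖ ^ ((n : ℝ) + s * p))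

open Set Filter Topology

set_option linter.unusedSectionVars false

/-! Let `mollify μ u k` be the convolution of `u` with a tent of mass one and radius `2 ^ (-k)`.
Telescoping over `k` writes `u x - u y` as an integral, over scales `k` and pairs `z`, of `u z.1 - u
z.2` against `atom μ (k, z) x - atom μ (k, z) y` (`integral_atom_sub_eq`). Each coefficient is given
to an index `i` that minimizes `2 ^ (k s i p i) |u z.1 - u z.2| ^ p i`, and `v i` is the
superposition of the atoms given to `i`.

Two estimates carry the bound. By `exists_lintegral_atom_rpow_le`, the `(s i, p i)` energy of a
superposition is at most a constant times the integral of `2 ^ (k (dim + s i p i)) |c| ^ p i` over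
`(k, z)` with `|z.1 - z.2| ≤ 2 · 2 ^ (-k)`. By the choice of `i` the integrand is at most `2 ^ (k
dim)` times the minimum over all indices, and summing over the scales `2 ^ k ≲ 1 / |z.1 - z.2|`, a
geometric series, gives back the integral of the minimum (`exists_lintegral_scaleEnergy_le`). The
maximum over `i` is bounded by the sum.

If the right side is infinite, nothing needs proof. If it is finite, `u` is locally integrable and
the coarse averages at two points approach each other, so the telescoping has no remainder. The
superpositions themselves may diverge at coarse scales; only their differences from a base point are
integrated. -/

/-! ### Dyadic sums, weighted Jensen inequality and the scale weight. -/

theorem summable_min_zpow_rpow {a b : ℝ} (ha : 0 < a) (hb : 0 < b) :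
    Summable fun k : ℤ => min (((2 : ℝ) ^ k) ^ a) (((2 : ℝ) ^ k) ^ (-b)) := by
  have key : ∀ c : ℝ, 0 < c → Summable fun n : ℕ => ((2 : ℝ) ^ (-c)) ^ n := fun c hc =>
    summable_geometric_of_lt_one (by positivity)
      (Real.rpow_lt_one_of_one_lt_of_neg one_lt_two (by linarith))
  have h0 : ∀ k : ℤ, 0 ≤ min (((2 : ℝ) ^ k) ^ a) (((2 : ℝ) ^ k) ^ (-b)) := fun k =>
    le_min (by positivity) (by positivity)
  refine Summable.of_nat_of_neg ?_ ?_
  · refine Summable.of_nonneg_of_le (fun n => h0 _) (fun n => (min_le_right _ _).trans ?_) (key b hb)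
    rw [zpow_natCast, ← Real.rpow_natCast, ← Real.rpow_natCast, ← Real.rpow_mul zero_le_two,
      ← Real.rpow_mul zero_le_two, mul_comm]
  · refine Summable.of_nonneg_of_le (fun n => h0 _) (fun n => (min_le_left _ _).trans ?_) (key a ha)
    rw [zpow_neg, zpow_natCast, ← Real.rpow_natCast, ← Real.rpow_natCast,
      ← Real.rpow_neg zero_le_two, ← Real.rpow_mul zero_le_two, ← Real.rpow_mul zero_le_two]
    exact le_of_eq (by ring_nf)

/-- Shifting the index by the `j` with `2 ^ j ≤ r < 2 ^ (j + 1)` reduces to `r = 1`, at the cost of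
a factor `2 ^ a`; hence the uniformity in `r`. -/
theorem exists_tsum_min_rpow_le {a b : ℝ} (ha : 0 < a) (hb : 0 < b) :
    ∃ C : ℝ≥0, ∀ r : ℝ, 0 < r →
      ∑' k : ℤ, ENNReal.ofReal (min (((2 : ℝ) ^ k * r) ^ a) (((2 : ℝ) ^ k * r) ^ (-b))) ≤ C := by
  set f : ℤ → ℝ := fun k => min (((2 : ℝ) ^ k) ^ a) (((2 : ℝ) ^ k) ^ (-b)) with hf
  have h0 : ∀ k : ℤ, 0 ≤ f k := fun k => le_min (by positivity) (by positivity)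
  have hfs : Summable f := summable_min_zpow_rpow ha hb
  have htop : ENNReal.ofReal (2 ^ a) * ∑' k, ENNReal.ofReal (f k) ≠ ∞ :=
    ENNReal.mul_ne_top ENNReal.ofReal_ne_top hfs.tsum_ofReal_ne_top
  refine ⟨(ENNReal.ofReal (2 ^ a) * ∑' k, ENNReal.ofReal (f k)).toNNReal, fun r hr => ?_⟩
  rw [ENNReal.coe_toNNReal htop]
  obtain ⟨j, hj1, hj2⟩ := exists_mem_Ico_zpow hr one_lt_two
  rw [← (Equiv.addRight j).tsum_eq (fun k => ENNReal.ofReal (f k)), ← ENNReal.tsum_mul_left]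
  refine ENNReal.tsum_le_tsum fun k => ?_
  rw [← ENNReal.ofReal_mul (by positivity)]
  refine ENNReal.ofReal_le_ofReal ?_
  have hk : (0 : ℝ) < 2 ^ k := by positivity
  have e1 : (2 : ℝ) ^ (k + j) ≤ 2 ^ k * r := by
    rw [zpow_add₀ two_ne_zero]; gcongr
  have e2 : (2 : ℝ) ^ k * r ≤ 2 * 2 ^ (k + j) := by
    rw [zpow_add₀ two_ne_zero]
    rw [zpow_add_one₀ two_ne_zero] at hj2
    nlinarith
  simp only [hf, Equiv.coe_addRight]
  rw [mul_min_of_nonneg _ _ (by positivity)]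
  refine min_le_min ?_ ?_
  · rw [← Real.mul_rpow zero_le_two (by positivity)]
    exact Real.rpow_le_rpow (by positivity) e2 ha.le
  · refine (Real.rpow_le_rpow_of_nonpos (by positivity) e1 (by linarith)).trans ?_
    exact le_mul_of_one_le_left (by positivity) (Real.one_le_rpow one_le_two ha.le)

/-- Jensen's inequality for the measure with density `W`, in multiplicative form. -/
theorem lintegral_mul_rpow_le {X : Type*} [MeasurableSpace X] {μ : Measure X} {W f : X → ℝ≥0∞}
    (hW : Measurable W) (hf : Measurable f) {p : ℝ} (hp : 1 ≤ p) :
    (∫⁻ x, W x * f x ∂μ) ^ p ≤ (∫⁻ x, W x ∂μ) ^ (p - 1) * ∫⁻ x, W x * f x ^ p ∂μ := by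
  rcases hp.eq_or_lt with rfl | hp1
  · simp
  have hp0 : 0 < p := by linarith
  have hq := Real.HolderConjugate.conjExponent hp1
  have h := ENNReal.lintegral_mul_le_Lp_mul_Lq (μ.withDensity W) hq hf.aemeasurable
    (measurable_const (a := (1 : ℝ≥0∞))).aemeasurable
  simp only [Pi.mul_apply, mul_one, ENNReal.one_rpow] at h
  rw [lintegral_withDensity_eq_lintegral_mul _ hW hf,
    lintegral_withDensity_eq_lintegral_mul _ hW (hf.pow_const p),
    lintegral_withDensity_eq_lintegral_mul _ hW measurable_const] at h
  simp only [Pi.mul_apply, mul_one] at h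
  calc _ ≤ _ := ENNReal.rpow_le_rpow h hp0.le
    _ = _ := by
      rw [ENNReal.mul_rpow_of_nonneg _ _ hp0.le, ← ENNReal.rpow_mul, ← ENNReal.rpow_mul, mul_comm]
      congr 2
      · rw [Real.conjExponent]; field_simp
      · rw [one_div_mul_cancel hp0.ne', ENNReal.rpow_one]

/-- The weight `min (1, τ) τ ^ (-s)`, written so as to be homogeneous on either side of `1`. -/
noncomputable def scaleWeight (s τ : ℝ) : ℝ := min (τ ^ (1 - s)) (τ ^ (-s))

theorem scaleWeight_nonneg (s : ℝ) {τ : ℝ} (hτ : 0 ≤ τ) : 0 ≤ scaleWeight s τ :=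
  le_min (by positivity) (by positivity)

@[fun_prop]
theorem measurable_scaleWeight (s : ℝ) : Measurable (scaleWeight s) := by
  unfold scaleWeight; fun_prop

theorem min_le_scaleWeight_mul {s τ : ℝ} (hτ : 0 ≤ τ) :
    min 1 τ ≤ scaleWeight s τ * τ ^ s := by
  rcases hτ.eq_or_lt with rfl | hτ
  · simp only [zero_le_one, inf_of_le_right]
    exact mul_nonneg (scaleWeight_nonneg s le_rfl) (by positivity)
  · rw [scaleWeight, min_mul_of_nonneg _ _ (by positivity), ← Real.rpow_add hτ,
      ← Real.rpow_add hτ, min_comm]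
    simp

/-! ### Dilation-invariant integrals of the scale weight. -/

section Haar

variable {E : Type*} [NormedAddCommGroup E] [NormedSpace ℝ E] [FiniteDimensional ℝ E]
  [MeasurableSpace E] [BorelSpace E] (μ : Measure E) [μ.IsAddHaarMeasure]

local notation "dim" => Module.finrank ℝ E

theorem lintegral_comp_smul_addHaar (f : E → ℝ≥0∞) (hf : Measurable f) {t : ℝ} (ht : 0 < t) :
    ∫⁻ x, f (t • x) ∂μ = ENNReal.ofReal ((t ^ dim)⁻¹) * ∫⁻ x, f x ∂μ := by
  rw [← lintegral_map hf (measurable_const_smul t), Measure.map_addHaar_smul μ ht.ne',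
    lintegral_smul_measure, abs_of_pos (by positivity), smul_eq_mul]

/-- In polar coordinates the radial integrand is at most `r ^ (-s)` near `0` and `r ^ (-s - 1)` near
infinity, so both `s < 1` and `0 < s` are needed. -/
theorem lintegral_scaleWeight_ne_top [Nontrivial E] {s : ℝ} (hs0 : 0 < s) (hs1 : s < 1) :
    ∫⁻ x : E, ENNReal.ofReal (scaleWeight s ‖x‖ * ‖x‖ ^ (-(dim : ℝ))) ∂μ ≠ ∞ := by
  have hd : 0 < dim := Module.finrank_pos
  have key : IntegrableOn (fun y : ℝ => y ^ (dim - 1) • (scaleWeight s y * y ^ (-(dim : ℝ))))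
      (Ioi 0) volume := by
    have hr : ∀ y : ℝ, 0 < y → ∀ a : ℝ, y ^ (dim - 1) • (y ^ a * y ^ (-(dim : ℝ))) = y ^ (a - 1) := by
      intro y hy a
      rw [smul_eq_mul, ← Real.rpow_natCast, ← Real.rpow_add hy, ← Real.rpow_add hy,
        Nat.cast_sub hd]
      congr 1
      push_cast
      ring
    have hm : Measurable (fun y : ℝ => y ^ (dim - 1) • (scaleWeight s y * y ^ (-(dim : ℝ)))) := by
      fun_prop
    rw [← Ioc_union_Ioi_eq_Ioi zero_le_one]
    refine IntegrableOn.union ?_ ?_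
    · have h1 : IntegrableOn (fun y : ℝ => y ^ (-s)) (Ioc 0 1) volume :=
        (intervalIntegrable_iff_integrableOn_Ioc_of_le zero_le_one).1
          (intervalIntegral.intervalIntegrable_rpow' (by linarith))
      refine h1.mono' hm.aestronglyMeasurable ?_
      filter_upwards [ae_restrict_mem measurableSet_Ioc] with y hy
      have hy0 := hy.1
      rw [Real.norm_of_nonneg (smul_nonneg (by positivity)
        (mul_nonneg (scaleWeight_nonneg s hy0.le) (by positivity)))]
      have := hr y hy0 (1 - s)
      rw [show 1 - s - 1 = -s by ring] at this
      rw [← this]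
      simp only [smul_eq_mul]
      gcongr
      exact min_le_left _ _
    · have h1 : IntegrableOn (fun y : ℝ => y ^ (-s - 1)) (Ioi 1) volume :=
        integrableOn_Ioi_rpow_of_lt (by linarith) one_pos
      refine h1.mono' hm.aestronglyMeasurable ?_
      filter_upwards [ae_restrict_mem measurableSet_Ioi] with y hy
      have hy0 : 0 < y := one_pos.trans hy
      rw [Real.norm_of_nonneg (smul_nonneg (by positivity)
        (mul_nonneg (scaleWeight_nonneg s hy0.le) (by positivity))), ← hr y hy0 (-s)]
      simp only [smul_eq_mul]
      gcongr
      exact min_le_right _ _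
  have h2 := (integrable_fun_norm_addHaar μ
    (f := fun y : ℝ => scaleWeight s y * y ^ (-(dim : ℝ)))).2 key
  exact (hasFiniteIntegral_iff_ofReal (ae_of_all _ fun x =>
    mul_nonneg (scaleWeight_nonneg s (norm_nonneg x)) (by positivity))).1 h2.2 |>.ne

/-- The measure `‖y‖ ^ (-dim) dy` is invariant under dilations, so the scale `t` drops out. -/
theorem lintegral_scaleWeight_dilation {s t : ℝ} (ht : 0 < t) (x : E) :
    ∫⁻ y : E, ENNReal.ofReal (scaleWeight s (t * ‖x - y‖) * ‖x - y‖ ^ (-(dim : ℝ))) ∂μ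
      = ∫⁻ y : E, ENNReal.ofReal (scaleWeight s ‖y‖ * ‖y‖ ^ (-(dim : ℝ))) ∂μ := by
  rw [lintegral_sub_left_eq_self
    (fun y : E => ENNReal.ofReal (scaleWeight s (t * ‖y‖) * ‖y‖ ^ (-(dim : ℝ)))) x]
  have h := lintegral_comp_smul_addHaar μ
    (fun y : E => ENNReal.ofReal (scaleWeight s ‖y‖ * ‖y‖ ^ (-(dim : ℝ)))) (by fun_prop) ht
  have hT : ENNReal.ofReal (t ^ dim) * ENNReal.ofReal ((t ^ dim)⁻¹) = 1 := by
    rw [← ENNReal.ofReal_mul (by positivity), mul_inv_cancel₀ (by positivity), ENNReal.ofReal_one]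
  rw [← one_mul (∫⁻ y : E, ENNReal.ofReal (scaleWeight s ‖y‖ * ‖y‖ ^ (-(dim : ℝ))) ∂μ), ← hT,
    mul_assoc, ← h, ← lintegral_const_mul _ (by fun_prop)]
  refine lintegral_congr fun y => ?_
  rw [← ENNReal.ofReal_mul (by positivity), norm_smul, Real.norm_of_nonneg ht.le,
    Real.mul_rpow ht.le (norm_nonneg y), Real.rpow_neg ht.le, Real.rpow_natCast]
  congr 1
  field_simp

end Haar

/-! ### Tent kernels and atoms. -/

section Kernel

variable {E : Type*} [NormedAddCommGroup E] [NormedSpace ℝ E] [FiniteDimensional ℝ E]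
  [MeasurableSpace E] [BorelSpace E] (μ : Measure E) [μ.IsAddHaarMeasure]

local notation "dim" => Module.finrank ℝ E

/-- The mass of the tent function `max (0, 1 - |x|)`. -/
noncomputable def tentMass : ℝ := ∫ x : E, max 0 (1 - ‖x‖) ∂μ

theorem hasCompactSupport_tent : HasCompactSupport fun x : E => max 0 (1 - ‖x‖) := by
  refine HasCompactSupport.of_support_subset_isCompact (isCompact_closedBall (0 : E) 1) ?_
  intro x hx
  rw [mem_closedBall_zero_iff]
  by_contra h
  exact hx (max_eq_left (by linarith))

theorem integrable_tent : Integrable (fun x : E => max 0 (1 - ‖x‖)) μ :=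
  (by fun_prop : Continuous fun x : E => max 0 (1 - ‖x‖)).integrable_of_hasCompactSupport
    hasCompactSupport_tent

theorem tentMass_pos : 0 < tentMass μ := by
  have hcont : Continuous fun x : E => max 0 (1 - ‖x‖) := by fun_prop
  refine hcont.integral_pos_of_hasCompactSupport_nonneg_nonzero
    hasCompactSupport_tent (fun x => le_max_left _ _) (x := 0) ?_
  simp

/-- The `L¹`-normalized tent function at inverse scale `t`. -/
noncomputable def tentKernel (t : ℝ) (x : E) : ℝ :=
  (tentMass μ)⁻¹ * (t ^ dim * max 0 (1 - t * ‖x‖))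

variable {μ} {t : ℝ} {x y : E}

theorem tentKernel_nonneg (ht : 0 < t) : 0 ≤ tentKernel μ t x := by
  have := tentMass_pos μ
  unfold tentKernel
  positivity

theorem tentKernel_le (ht : 0 < t) : tentKernel μ t x ≤ (tentMass μ)⁻¹ * t ^ dim := by
  have := tentMass_pos μ
  unfold tentKernel
  gcongr
  refine mul_le_of_le_one_right (by positivity) (max_le zero_le_one ?_)
  have : 0 ≤ t * ‖x‖ := by positivity
  linarith

theorem tentKernel_eq_zero (h : 1 ≤ t * ‖x‖) : tentKernel μ t x = 0 := by
  rw [tentKernel, max_eq_left (by linarith)]; simp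

theorem abs_tentKernel_sub_le (ht : 0 < t) :
    |tentKernel μ t x - tentKernel μ t y| ≤ (tentMass μ)⁻¹ * t ^ (dim + 1) * ‖x - y‖ := by
  have := tentMass_pos μ
  have h1 : |max 0 (1 - t * ‖x‖) - max 0 (1 - t * ‖y‖)| ≤ t * ‖x - y‖ := by
    refine (abs_max_sub_max_le_max _ _ _ _).trans ?_
    rw [sub_self, abs_zero, max_eq_right (abs_nonneg _)]
    rw [show 1 - t * ‖x‖ - (1 - t * ‖y‖) = t * (‖y‖ - ‖x‖) by ring, abs_mul, abs_of_pos ht,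
      norm_sub_rev]
    gcongr
    exact abs_norm_sub_norm_le y x
  rw [tentKernel, tentKernel, ← mul_sub, ← mul_sub, abs_mul, abs_mul, abs_of_pos (by positivity),
    abs_of_pos (by positivity : 0 < t ^ dim), pow_succ, mul_assoc, mul_assoc]
  gcongr

variable (μ) in
theorem measurable_tentKernel : Measurable fun q : ℝ × E => tentKernel μ q.1 q.2 := by
  unfold tentKernel; fun_prop

@[fun_prop]
theorem Measurable.tentKernel {X : Type*} [MeasurableSpace X] {f : X → ℝ} {g : X → E}
    (hf : Measurable f) (hg : Measurable g) : Measurable fun a => _root_.tentKernel μ (f a) (g a) :=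
  (measurable_tentKernel μ).comp (hf.prodMk hg)

theorem integral_tentKernel (ht : 0 < t) : ∫ x : E, tentKernel μ t x ∂μ = 1 := by
  have h := Measure.integral_comp_smul μ (fun x : E => max 0 (1 - ‖x‖)) t
  simp only [norm_smul, Real.norm_of_nonneg ht.le, smul_eq_mul] at h
  unfold tentKernel
  rw [integral_const_mul, integral_const_mul, h, ← tentMass, abs_of_pos (by positivity)]
  have := tentMass_pos μ
  field_simp

theorem continuous_tentKernel : Continuous fun x : E => tentKernel μ t x := by
  unfold tentKernel; fun_prop

theorem integrable_tentKernel_sub_mul (ht : 0 < t) (x : E) {u : E → ℝ}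
    (hu : LocallyIntegrable u μ) : Integrable (fun z => tentKernel μ t (x - z) * u z) μ := by
  refine hu.integrable_smul_left_of_hasCompactSupport (𝕜 := ℝ)
    (continuous_tentKernel.comp (by fun_prop)) ?_
  refine HasCompactSupport.of_support_subset_isCompact (isCompact_closedBall x t⁻¹) ?_
  intro z hz
  rw [Metric.mem_closedBall, dist_comm, dist_eq_norm]
  by_contra h
  rw [not_le, inv_lt_iff_one_lt_mul₀' ht] at h
  exact hz (tentKernel_eq_zero h.le)

theorem integral_tentKernel_sub (ht : 0 < t) (x : E) :
    ∫ z : E, tentKernel μ t (x - z) ∂μ = 1 := by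
  rw [integral_sub_left_eq_self (fun z => tentKernel μ t z) μ x, integral_tentKernel ht]

variable (μ) in
/-- The product of the kernels at the scales `2 ^ (-k-1)` and `2 ^ (-k)`, centred at `z.1` and `z.2`. -/
noncomputable def atom (a : ℤ × E × E) (x : E) : ℝ :=
  tentKernel μ (2 ^ (a.1 + 1)) (x - a.2.1) * tentKernel μ (2 ^ a.1) (x - a.2.2)

@[fun_prop]
theorem measurable_two_zpow {X : Type*} [MeasurableSpace X] {f : X → ℤ} (hf : Measurable f) :
    Measurable fun x => (2 : ℝ) ^ f x :=
  (Measurable.of_discrete (f := fun k : ℤ => (2 : ℝ) ^ k)).comp hf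

@[fun_prop]
theorem Measurable.atom {X : Type*} [MeasurableSpace X] {f : X → ℤ × E × E} {g : X → E}
    (hf : Measurable f) (hg : Measurable g) : Measurable fun a => _root_.atom μ (f a) (g a) := by
  unfold _root_.atom
  fun_prop

/-- The indicator of the set of `x` which lie within `2 ^ (-k)` of both `z.1` and `z.2`. -/
noncomputable def near (a : ℤ × E × E) (x : E) : ℝ≥0∞ :=
  if (2 : ℝ) ^ a.1 * ‖x - a.2.1‖ ≤ 1 ∧ (2 : ℝ) ^ a.1 * ‖x - a.2.2‖ ≤ 1 then 1 else 0

/-- The indicator of the set of `(k, z)` with `|z.1 - z.2| ≤ A 2 ^ (-k)`. -/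
noncomputable def closeInd (A : ℝ) (a : ℤ × E × E) : ℝ≥0∞ :=
  if (2 : ℝ) ^ a.1 * ‖a.2.1 - a.2.2‖ ≤ A then 1 else 0

@[fun_prop]
theorem Measurable.near {X : Type*} [MeasurableSpace X] {f : X → ℤ × E × E} {g : X → E}
    (hf : Measurable f) (hg : Measurable g) : Measurable fun a => _root_.near (f a) (g a) := by
  unfold _root_.near
  refine Measurable.ite ?_ measurable_const measurable_const
  have h1 : Measurable fun a => (2 : ℝ) ^ (f a).1 * ‖g a - (f a).2.1‖ := by fun_prop
  have h2 : Measurable fun a => (2 : ℝ) ^ (f a).1 * ‖g a - (f a).2.2‖ := by fun_prop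
  exact (measurableSet_le h1 measurable_const).inter (measurableSet_le h2 measurable_const)

@[fun_prop]
theorem measurable_closeInd (A : ℝ) : Measurable (closeInd (E := E) A) := by
  unfold closeInd
  exact Measurable.ite (measurableSet_le (by fun_prop) (by fun_prop)) measurable_const
    measurable_const

theorem atom_eq_zero_of_near {a : ℤ × E × E} (h : near a x = 0) : atom μ a x = 0 := by
  rw [near, ite_eq_right_iff] at h
  simp only [one_ne_zero, imp_false, not_and_or, not_le] at h
  rw [atom]
  rcases h with h | h
  · rw [tentKernel_eq_zero, zero_mul]
    rw [zpow_add_one₀ two_ne_zero]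
    nlinarith
  · rw [tentKernel_eq_zero h.le, mul_zero]

-- Size bound when the minimum is `1`, Lipschitz bound otherwise. The product rule gives `2 ^ (dim +
-- 1) + 2 ^ dim = 3 * 2 ^ dim`, the finer kernel contributing the first term.
variable (μ) in
theorem enorm_atom_sub_le (a : ℤ × E × E) (x y : E) :
    ‖atom μ a x - atom μ a y‖ₑ ≤ ENNReal.ofReal (3 * 2 ^ dim * (tentMass μ)⁻¹ ^ 2) *
      (ENNReal.ofReal (((2 : ℝ) ^ a.1) ^ (2 * dim) * min 1 (2 ^ a.1 * ‖x - y‖)) *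
        (near a x + near a y)) := by
  by_cases h : near a x = 0 ∧ near a y = 0
  · rw [atom_eq_zero_of_near h.1, atom_eq_zero_of_near h.2]
    simp
  have h1 : 1 ≤ near a x + near a y := by
    rw [not_and_or] at h
    have key : ∀ w, near a w ≠ 0 → near a w = 1 := fun w hw => by
      unfold near at hw ⊢
      split_ifs at hw ⊢ <;> simp_all
    rcases h with h | h
    · exact (key x h).symm.le.trans le_self_add
    · exact (key y h).symm.le.trans le_add_self
  rw [← mul_assoc]
  refine le_mul_of_le_of_one_le ?_ h1
  have hc := tentMass_pos μ
  rw [← ENNReal.ofReal_mul (by positivity), Real.enorm_eq_ofReal_abs]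
  refine ENNReal.ofReal_le_ofReal ?_
  set t : ℝ := 2 ^ a.1 with ht
  have ht0 : 0 < t := by positivity
  have hT : (2 : ℝ) ^ (a.1 + 1) = 2 * t := by rw [zpow_add_one₀ two_ne_zero, mul_comm]
  have hT0 : 0 < 2 * t := by positivity
  unfold atom
  rw [hT, ← ht]
  set c := (tentMass μ)⁻¹ with hcdef
  have hc0 : 0 < c := by positivity
  have A0 : ∀ w, 0 ≤ tentKernel μ (2 * t) w := fun w => tentKernel_nonneg hT0
  have A1 : ∀ w, tentKernel μ (2 * t) w ≤ c * (2 * t) ^ dim := fun w => tentKernel_le hT0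
  have B0 : ∀ w, 0 ≤ tentKernel μ t w := fun w => tentKernel_nonneg ht0
  have B1 : ∀ w, tentKernel μ t w ≤ c * t ^ dim := fun w => tentKernel_le ht0
  rw [mul_min_of_nonneg _ _ (by positivity), mul_min_of_nonneg _ _ (by positivity)]
  refine le_min ?_ ?_
  · have hle : ∀ w, tentKernel μ (2 * t) (w - a.2.1) * tentKernel μ t (w - a.2.2)
        ≤ c * (2 * t) ^ dim * (c * t ^ dim) := fun w =>
      mul_le_mul (A1 _) (B1 _) (B0 _) (by positivity)
    have h0 : ∀ w, 0 ≤ tentKernel μ (2 * t) (w - a.2.1) * tentKernel μ t (w - a.2.2) := fun w =>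
      mul_nonneg (A0 _) (B0 _)
    refine (abs_sub_le_of_nonneg_of_le (h0 x) (hle x) (h0 y) (hle y)).trans ?_
    rw [mul_pow, two_mul dim, pow_add]
    have : 0 ≤ 2 ^ dim * c ^ 2 * (t ^ dim * t ^ dim) := by positivity
    nlinarith
  · have hA := abs_tentKernel_sub_le (μ := μ) hT0 (x := x - a.2.1) (y := y - a.2.1)
    have hB := abs_tentKernel_sub_le (μ := μ) ht0 (x := x - a.2.2) (y := y - a.2.2)
    rw [sub_sub_sub_cancel_right, ← hcdef] at hA hB
    calc |tentKernel μ (2 * t) (x - a.2.1) * tentKernel μ t (x - a.2.2)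
          - tentKernel μ (2 * t) (y - a.2.1) * tentKernel μ t (y - a.2.2)|
        = |(tentKernel μ (2 * t) (x - a.2.1) - tentKernel μ (2 * t) (y - a.2.1))
              * tentKernel μ t (x - a.2.2)
          + tentKernel μ (2 * t) (y - a.2.1)
              * (tentKernel μ t (x - a.2.2) - tentKernel μ t (y - a.2.2))| := by congr 1; ring
      _ ≤ c * (2 * t) ^ (dim + 1) * ‖x - y‖ * (c * t ^ dim)
          + c * (2 * t) ^ dim * (c * t ^ (dim + 1) * ‖x - y‖) := by
        refine (abs_add_le _ _).trans ?_
        rw [abs_mul, abs_mul, abs_of_nonneg (B0 _), abs_of_nonneg (A0 _)]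
        exact add_le_add (mul_le_mul hA (B1 _) (B0 _) (by positivity))
          (mul_le_mul (A1 _) hB (abs_nonneg _) (by positivity))
      _ = _ := by rw [mul_pow, mul_pow, two_mul dim, pow_add, pow_succ, pow_succ]; ring

end Kernel

/-! ### Energy of a superposition of atoms. -/

section Atoms

variable {E : Type*} [NormedAddCommGroup E] [NormedSpace ℝ E] [FiniteDimensional ℝ E]
  [MeasurableSpace E] [BorelSpace E] (μ : Measure E) [μ.IsAddHaarMeasure]

local notation "dim" => Module.finrank ℝ E

theorem mul_norm_sub_le_iff {t : ℝ} (ht : 0 < t) {x z : E} {A : ℝ} :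
    t * ‖x - z‖ ≤ A ↔ z ∈ Metric.closedBall x (A / t) := by
  rw [mem_closedBall_iff_norm', le_div_iff₀' ht]

theorem addHaar_closedBall_div (x : E) {A t : ℝ} (hA : 0 ≤ A) (ht : 0 < t) :
    μ (Metric.closedBall x (A / t))
      = ENNReal.ofReal (A ^ dim * (t ^ dim)⁻¹) * μ (Metric.ball 0 1) := by
  rw [Measure.addHaar_closedBall μ x (by positivity), div_pow, div_eq_mul_inv]

theorem lintegral_near_index (k : ℤ) (x : E) :
    ∫⁻ z : E × E, near (k, z) x ∂(μ.prod μ)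
      = (ENNReal.ofReal ((((2 : ℝ) ^ k) ^ dim)⁻¹) * μ (Metric.ball 0 1)) ^ 2 := by
  have ht : (0 : ℝ) < 2 ^ k := by positivity
  have h : (fun z : E × E => near (k, z) x) = indicator
      (Metric.closedBall x (1 / 2 ^ k) ×ˢ Metric.closedBall x (1 / 2 ^ k)) 1 := by
    ext z
    have hiff : (2 : ℝ) ^ k * ‖x - z.1‖ ≤ 1 ∧ (2 : ℝ) ^ k * ‖x - z.2‖ ≤ 1 ↔
        z ∈ Metric.closedBall x (1 / 2 ^ k) ×ˢ Metric.closedBall x (1 / 2 ^ k) := by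
      rw [mul_norm_sub_le_iff ht, mul_norm_sub_le_iff ht, mem_prod]
    by_cases h : z ∈ Metric.closedBall x (1 / 2 ^ k) ×ˢ Metric.closedBall x (1 / 2 ^ k)
    · rw [indicator_of_mem h, near, if_pos (hiff.2 h), Pi.one_apply]
    · rw [indicator_of_notMem h, near, if_neg (mt hiff.1 h)]
  rw [h, lintegral_indicator_one (by measurability), Measure.prod_prod, ← sq,
    addHaar_closedBall_div μ x zero_le_one ht, one_pow, one_mul]

/-- A point near both centres forces the centres within `2 · 2 ^ (-k)` of each other. This is the
source of the restriction on pairs in the energy bound. -/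
theorem lintegral_near_le (a : ℤ × E × E) :
    ∫⁻ x : E, near a x ∂μ ≤
      ENNReal.ofReal ((((2 : ℝ) ^ a.1) ^ dim)⁻¹) * μ (Metric.ball 0 1) * closeInd 2 a := by
  have ht : (0 : ℝ) < 2 ^ a.1 := by positivity
  have h : ∀ x, near a x ≤ indicator (Metric.closedBall a.2.1 (1 / 2 ^ a.1)) 1 x * closeInd 2 a := by
    intro x
    by_cases hx : (2 : ℝ) ^ a.1 * ‖x - a.2.1‖ ≤ 1 ∧ (2 : ℝ) ^ a.1 * ‖x - a.2.2‖ ≤ 1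
    · have h1 : x ∈ Metric.closedBall a.2.1 (1 / 2 ^ a.1) := by
        rw [← mul_norm_sub_le_iff ht, norm_sub_rev]; exact hx.1
      have h2 : (2 : ℝ) ^ a.1 * ‖a.2.1 - a.2.2‖ ≤ 2 := by
        have := norm_sub_le (x - a.2.2) (x - a.2.1)
        rw [sub_sub_sub_cancel_left] at this
        nlinarith [hx.1, hx.2]
      rw [indicator_of_mem h1, near, if_pos hx, closeInd, if_pos h2]; simp
    · rw [near, if_neg hx]; exact zero_le
  refine (lintegral_mono h).trans_eq ?_
  rw [lintegral_mul_const _ (measurable_one.indicator Metric.isClosed_closedBall.measurableSet),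
    lintegral_indicator_one Metric.isClosed_closedBall.measurableSet,
    addHaar_closedBall_div μ _ zero_le_one ht, one_pow, one_mul]

/-- Integrating out the centres cancels `2 ^ (2 k dim)`, which leaves a dyadic sum of `scaleWeight`.
This is the total mass of the weight in Jensen's inequality. -/
theorem exists_lintegral_weight_le {s : ℝ} (hs0 : 0 < s) (hs1 : s < 1) :
    ∃ C : ℝ≥0, ∀ x y : E,
      ∫⁻ a : ℤ × E × E, ENNReal.ofReal (((2 : ℝ) ^ a.1) ^ (2 * dim) *
        scaleWeight s (2 ^ a.1 * ‖x - y‖)) * (near a x + near a y)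
          ∂(Measure.count.prod (μ.prod μ)) ≤ C := by
  obtain ⟨C, hC⟩ := exists_tsum_min_rpow_le (sub_pos.2 hs1) hs0
  have hV : μ (Metric.ball (0 : E) 1) ≠ ∞ := measure_ball_lt_top.ne
  have htop : C * (2 * μ (Metric.ball (0 : E) 1) ^ 2) ≠ ∞ :=
    ENNReal.mul_ne_top ENNReal.coe_ne_top (ENNReal.mul_ne_top (by simp) (ENNReal.pow_ne_top hV))
  refine ⟨(C * (2 * μ (Metric.ball (0 : E) 1) ^ 2)).toNNReal, fun x y => ?_⟩
  rw [ENNReal.coe_toNNReal htop, lintegral_prod _ (by fun_prop), lintegral_count]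
  have key : ∀ k : ℤ, ∫⁻ z : E × E, ENNReal.ofReal (((2 : ℝ) ^ k) ^ (2 * dim) *
      scaleWeight s (2 ^ k * ‖x - y‖)) * (near (k, z) x + near (k, z) y) ∂(μ.prod μ)
      = ENNReal.ofReal (scaleWeight s (2 ^ k * ‖x - y‖)) * (2 * μ (Metric.ball (0 : E) 1) ^ 2) := by
    intro k
    rw [lintegral_const_mul _ (by fun_prop), lintegral_add_left (by fun_prop),
      lintegral_near_index, lintegral_near_index, ← two_mul, mul_pow,
      ← ENNReal.ofReal_pow (by positivity), ENNReal.ofReal_mul (by positivity)]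
    have : ENNReal.ofReal (((2 : ℝ) ^ k) ^ (2 * dim)) *
        ENNReal.ofReal (((((2 : ℝ) ^ k) ^ dim)⁻¹) ^ 2) = 1 := by
      rw [← ENNReal.ofReal_mul (by positivity), inv_pow, ← pow_mul, mul_comm dim 2,
        mul_inv_cancel₀ (by positivity), ENNReal.ofReal_one]
    calc _ = (ENNReal.ofReal (((2 : ℝ) ^ k) ^ (2 * dim)) *
        ENNReal.ofReal (((((2 : ℝ) ^ k) ^ dim)⁻¹) ^ 2)) * (ENNReal.ofReal
          (scaleWeight s (2 ^ k * ‖x - y‖)) * (2 * μ (Metric.ball (0 : E) 1) ^ 2)) := by ring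
      _ = _ := by rw [this, one_mul]
  simp only [key]
  rw [ENNReal.tsum_mul_right]
  gcongr
  rcases (norm_nonneg (x - y)).eq_or_lt with h | h
  -- At `x = y` the weight vanishes, because real powers of `0` with nonzero exponent are `0`.
  · rw [← h]
    simp [scaleWeight, Real.zero_rpow (sub_pos.2 hs1).ne', Real.zero_rpow (neg_ne_zero.2 hs0.ne')]
  · exact hC _ h

/-- The Gagliardo energy of a superposition of atoms is controlled by the coefficients. -/
theorem exists_lintegral_atom_rpow_le [Nontrivial E] {s p : ℝ} (hs0 : 0 < s) (hs1 : s < 1)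
    (hp : 1 ≤ p) :
    ∃ C : ℝ≥0, ∀ c : ℤ × E × E → ℝ≥0∞, Measurable c →
      ∫⁻ w : E × E, (∫⁻ a, c a * ‖atom μ a w.1 - atom μ a w.2‖ₑ
          ∂(Measure.count.prod (μ.prod μ))) ^ p *
          ENNReal.ofReal (‖w.1 - w.2‖ ^ (-((dim : ℝ) + s * p))) ∂(μ.prod μ)
        ≤ C * ∫⁻ a : ℤ × E × E, closeInd 2 a * (ENNReal.ofReal (((2 : ℝ) ^ a.1) ^ ((dim : ℝ) + s * p))
            * c a ^ p) ∂(Measure.count.prod (μ.prod μ)) := by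
  have hp0 : 0 < p := by linarith
  obtain ⟨C₂, hC₂⟩ := exists_lintegral_weight_le μ hs0 hs1
  set V := μ (Metric.ball (0 : E) 1) with hVdef
  have hV : V ≠ ∞ := measure_ball_lt_top.ne
  set J := ∫⁻ x : E, ENNReal.ofReal (scaleWeight s ‖x‖ * ‖x‖ ^ (-(dim : ℝ))) ∂μ with hJdef
  have hJ : J ≠ ∞ := lintegral_scaleWeight_ne_top μ hs0 hs1
  set C₀ := ENNReal.ofReal (3 * 2 ^ dim * (tentMass μ)⁻¹ ^ 2) with hC₀
  have hC₀t : C₀ ≠ ∞ := ENNReal.ofReal_ne_top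
  set K := C₀ ^ p * (C₂ : ℝ≥0∞) ^ (p - 1) * (2 * J * V) with hK
  have hKt : K ≠ ∞ := by
    refine ENNReal.mul_ne_top (ENNReal.mul_ne_top ?_ ?_)
      (ENNReal.mul_ne_top (ENNReal.mul_ne_top (by simp) hJ) hV)
    · exact ENNReal.rpow_ne_top_of_nonneg hp0.le hC₀t
    · exact ENNReal.rpow_ne_top_of_nonneg (by linarith) ENNReal.coe_ne_top
  refine ⟨K.toNNReal, fun c hc => ?_⟩
  rw [ENNReal.coe_toNNReal hKt]
  set ν : Measure (ℤ × E × E) := Measure.count.prod (μ.prod μ) with hν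
  -- The factor `min 1 τ` is split as `scaleWeight s τ * τ ^ s`. The weight `W` has bounded mass,
  -- and `τ ^ s`, kept in `g`, cancels `‖w.1 - w.2‖ ^ (-(s * p))` after the `p`-th power; the
  -- remaining `‖w.1 - w.2‖ ^ (-dim)` is dilation invariant against the weight.
  set W : E × E → ℤ × E × E → ℝ≥0∞ := fun w a => ENNReal.ofReal (((2 : ℝ) ^ a.1) ^ (2 * dim) *
        scaleWeight s (2 ^ a.1 * ‖w.1 - w.2‖)) * (near a w.1 + near a w.2) with hW
  set g : E × E → ℤ × E × E → ℝ≥0∞ := fun w a =>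
    ENNReal.ofReal ((2 ^ a.1 * ‖w.1 - w.2‖) ^ s) * c a with hg
  have hF : ∀ w : E × E, ∫⁻ a, c a * ‖atom μ a w.1 - atom μ a w.2‖ₑ ∂ν
      ≤ C₀ * ∫⁻ a, W w a * g w a ∂ν := by
    intro w
    rw [← lintegral_const_mul _ (by fun_prop)]
    refine lintegral_mono fun a => ?_
    calc _ ≤ c a * _ := by exact mul_le_mul_right (enorm_atom_sub_le μ a w.1 w.2) _
      _ ≤ c a * (C₀ * ((ENNReal.ofReal (((2 : ℝ) ^ a.1) ^ (2 * dim) *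
          (scaleWeight s (2 ^ a.1 * ‖w.1 - w.2‖) * (2 ^ a.1 * ‖w.1 - w.2‖) ^ s)) *
          (near a w.1 + near a w.2)))) := by
        gcongr
        exact min_le_scaleWeight_mul (by positivity)
      _ = _ := by
        rw [← mul_assoc (((2 : ℝ) ^ a.1) ^ (2 * dim)),
          ENNReal.ofReal_mul (mul_nonneg (by positivity) (scaleWeight_nonneg s (by positivity)))]
        simp only [hW, hg]
        ring
  set G : E × E → ℤ × E × E → ℝ≥0∞ := fun w a =>
    (ENNReal.ofReal (((2 : ℝ) ^ a.1) ^ (2 * (dim : ℝ) + s * p)) * c a ^ p) *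
      (ENNReal.ofReal (scaleWeight s (2 ^ a.1 * ‖w.1 - w.2‖) * ‖w.1 - w.2‖ ^ (-(dim : ℝ))) *
        (near a w.1 + near a w.2)) with hG
  have hWG : ∀ w a, W w a * g w a ^ p * ENNReal.ofReal (‖w.1 - w.2‖ ^ (-((dim : ℝ) + s * p)))
      ≤ G w a := by
    intro w a
    have ht : (0 : ℝ) < 2 ^ a.1 := by positivity
    simp only [hW, hg, hG]
    rw [ENNReal.mul_rpow_of_nonneg _ _ hp0.le, ENNReal.ofReal_rpow_of_nonneg (by positivity) hp0.le]
    set r := ‖w.1 - w.2‖ with hr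
    have hr0 : 0 ≤ r := norm_nonneg _
    have hsw := scaleWeight_nonneg s (mul_nonneg ht.le hr0)
    have hreal : ((2 : ℝ) ^ a.1) ^ (2 * dim) * scaleWeight s (2 ^ a.1 * r) *
        ((2 ^ a.1 * r) ^ s) ^ p * r ^ (-((dim : ℝ) + s * p)) ≤
        ((2 : ℝ) ^ a.1) ^ (2 * (dim : ℝ) + s * p) *
          (scaleWeight s (2 ^ a.1 * r) * r ^ (-(dim : ℝ))) := by
      rcases hr0.eq_or_lt with h | h
      -- On the diagonal the left side is `0`, by the convention for powers of `0`.
      · have hne : -((dim : ℝ) + s * p) ≠ 0 := neg_ne_zero.2 (by positivity)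
        rw [← h, Real.zero_rpow hne, mul_zero]
        rw [← h] at hsw
        positivity
      · rw [← Real.rpow_mul (by positivity), Real.mul_rpow ht.le hr0, Real.rpow_add ht,
          neg_add, Real.rpow_add h, Real.rpow_neg hr0 (s * p), ← Real.rpow_natCast]
        push_cast
        have : r ^ (s * p) ≠ 0 := by positivity
        apply le_of_eq
        field_simp
    calc _ = ENNReal.ofReal (((2 : ℝ) ^ a.1) ^ (2 * dim) * scaleWeight s (2 ^ a.1 * r) *
        ((2 ^ a.1 * r) ^ s) ^ p * r ^ (-((dim : ℝ) + s * p))) * (c a ^ p *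
          (near a w.1 + near a w.2)) := by
          rw [ENNReal.ofReal_mul (p := ((2 : ℝ) ^ a.1) ^ (2 * dim) * scaleWeight s (2 ^ a.1 * r) *
              ((2 ^ a.1 * r) ^ s) ^ p) (by positivity),
            ENNReal.ofReal_mul (p := ((2 : ℝ) ^ a.1) ^ (2 * dim) * scaleWeight s (2 ^ a.1 * r))
              (by positivity)]
          ring
      _ ≤ _ := mul_le_mul_left (ENNReal.ofReal_le_ofReal hreal) _
      _ = _ := by
          rw [ENNReal.ofReal_mul (by positivity)]
          ring
  have hWm : Measurable (Function.uncurry W) := by simp only [hW, Function.uncurry_def]; fun_prop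
  have hgm : Measurable (Function.uncurry g) := by simp only [hg, Function.uncurry_def]; fun_prop
  have hGm : Measurable (Function.uncurry G) := by simp only [hG, Function.uncurry_def]; fun_prop
  have hpt : ∀ w : E × E, (∫⁻ a, c a * ‖atom μ a w.1 - atom μ a w.2‖ₑ ∂ν) ^ p *
      ENNReal.ofReal (‖w.1 - w.2‖ ^ (-((dim : ℝ) + s * p)))
      ≤ C₀ ^ p * (C₂ : ℝ≥0∞) ^ (p - 1) * ∫⁻ a, G w a ∂ν := by
    intro w
    have hWw : Measurable (W w) := hWm.of_uncurry_left
    have hgw : Measurable (g w) := hgm.of_uncurry_left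
    calc _ ≤ (C₀ * ∫⁻ a, W w a * g w a ∂ν) ^ p *
          ENNReal.ofReal (‖w.1 - w.2‖ ^ (-((dim : ℝ) + s * p))) := by gcongr; exact hF w
      _ ≤ C₀ ^ p * ((C₂ : ℝ≥0∞) ^ (p - 1) * ∫⁻ a, W w a * g w a ^ p ∂ν) *
          ENNReal.ofReal (‖w.1 - w.2‖ ^ (-((dim : ℝ) + s * p))) := by
        rw [ENNReal.mul_rpow_of_nonneg _ _ hp0.le]
        gcongr
        refine (lintegral_mul_rpow_le hWw hgw hp).trans ?_
        exact mul_le_mul_left (ENNReal.rpow_le_rpow (hC₂ w.1 w.2) (by linarith)) _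
      _ = C₀ ^ p * (C₂ : ℝ≥0∞) ^ (p - 1) * ∫⁻ a, W w a * g w a ^ p *
          ENNReal.ofReal (‖w.1 - w.2‖ ^ (-((dim : ℝ) + s * p))) ∂ν := by
        rw [lintegral_mul_const _ (by fun_prop)]; ring
      _ ≤ _ := by gcongr; exact hWG w _
  have hinner : ∀ a : ℤ × E × E, ∫⁻ w, G w a ∂(μ.prod μ) ≤ 2 * J * V * (closeInd 2 a *
      (ENNReal.ofReal (((2 : ℝ) ^ a.1) ^ ((dim : ℝ) + s * p)) * c a ^ p)) := by
    intro a
    have ht : (0 : ℝ) < 2 ^ a.1 := by positivity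
    set q : E × E → ℝ≥0∞ := fun w => ENNReal.ofReal (scaleWeight s (2 ^ a.1 * ‖w.1 - w.2‖) *
      ‖w.1 - w.2‖ ^ (-(dim : ℝ))) with hq
    have hqm : Measurable q := by simp only [hq]; fun_prop
    have h1 : ∫⁻ w, q w * near a w.1 ∂(μ.prod μ) = J * ∫⁻ x, near a x ∂μ := by
      rw [lintegral_prod _ (by fun_prop), ← lintegral_const_mul _ (by fun_prop)]
      refine lintegral_congr fun x => ?_
      simp only
      rw [lintegral_mul_const _ (by fun_prop), lintegral_scaleWeight_dilation μ ht x]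
    have h2 : ∫⁻ w, q w * near a w.2 ∂(μ.prod μ) = J * ∫⁻ x, near a x ∂μ := by
      rw [← h1, ← lintegral_prod_swap]
      refine lintegral_congr fun w => ?_
      simp only [hq, Prod.fst_swap, Prod.snd_swap, norm_sub_rev]
    simp only [hG]
    rw [lintegral_const_mul _ (by fun_prop)]
    simp only [mul_add]
    rw [lintegral_add_left (by fun_prop), h1, h2, ← two_mul]
    calc _ ≤ ENNReal.ofReal (((2 : ℝ) ^ a.1) ^ (2 * (dim : ℝ) + s * p)) * c a ^ p *
        (2 * (J * (ENNReal.ofReal ((((2 : ℝ) ^ a.1) ^ dim)⁻¹) * V * closeInd 2 a))) := by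
          gcongr; exact lintegral_near_le μ a
      _ = 2 * J * V * (closeInd 2 a * ((ENNReal.ofReal (((2 : ℝ) ^ a.1) ^ (2 * (dim : ℝ) + s * p)) *
          ENNReal.ofReal ((((2 : ℝ) ^ a.1) ^ dim)⁻¹)) * c a ^ p)) := by ring
      _ = _ := by
        rw [← ENNReal.ofReal_mul (by positivity), ← Real.rpow_natCast, ← Real.rpow_neg ht.le,
          ← Real.rpow_add ht]
        congr 5
        ring_nf
  calc _ ≤ ∫⁻ w, C₀ ^ p * (C₂ : ℝ≥0∞) ^ (p - 1) * ∫⁻ a, G w a ∂ν ∂(μ.prod μ) := lintegral_mono hpt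
    _ = C₀ ^ p * (C₂ : ℝ≥0∞) ^ (p - 1) * ∫⁻ a, ∫⁻ w, G w a ∂(μ.prod μ) ∂ν := by
      rw [lintegral_const_mul _ hGm.lintegral_prod_right, lintegral_lintegral_swap hGm.aemeasurable]
    _ ≤ C₀ ^ p * (C₂ : ℝ≥0∞) ^ (p - 1) * ∫⁻ a, 2 * J * V * (closeInd 2 a *
      (ENNReal.ofReal (((2 : ℝ) ^ a.1) ^ ((dim : ℝ) + s * p)) * c a ^ p)) ∂ν := by
      gcongr; exact hinner _
    _ = _ := by
      rw [lintegral_const_mul _ (by fun_prop), ← mul_assoc]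

end Atoms

/-! ### The minimum energy in dyadic form. -/

section Energy

variable {E : Type*} [NormedAddCommGroup E] [NormedSpace ℝ E] [FiniteDimensional ℝ E]
  [MeasurableSpace E] [BorelSpace E] (μ : Measure E) [μ.IsAddHaarMeasure]
  {ι : Type*} [Fintype ι] [Nonempty ι]

local notation "dim" => Module.finrank ℝ E

theorem exists_tsum_zpow_rpow_le {A β : ℝ} (hA : 0 < A) (hβ : 0 < β) :
    ∃ C : ℝ≥0, ∀ r : ℝ, 0 < r →
      ∑' k : ℤ, (if (2 : ℝ) ^ k * r ≤ A then 1 else 0) * ENNReal.ofReal (((2 : ℝ) ^ k) ^ β)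
        ≤ C * ENNReal.ofReal (r ^ (-β)) := by
  -- The decay exponent `1` is arbitrary: on the scales kept by the cutoff the minimum is the first
  -- term.
  obtain ⟨C, hC⟩ := exists_tsum_min_rpow_le hβ one_pos
  refine ⟨C * (A ^ β).toNNReal, fun r hr => ?_⟩
  have h := hC (r / A) (by positivity)
  rw [ENNReal.coe_mul, mul_assoc]
  refine le_trans ?_ (mul_le_mul_left h _)
  rw [← ENNReal.tsum_mul_right]
  refine ENNReal.tsum_le_tsum fun k => ?_
  split_ifs with hk
  · rw [one_mul, ← ENNReal.ofReal, ← ENNReal.ofReal_mul (by positivity),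
      ← ENNReal.ofReal_mul (le_min (by positivity) (by positivity))]
    refine ENNReal.ofReal_le_ofReal ?_
    have ht : (0 : ℝ) < 2 ^ k := by positivity
    have hτ : (2 : ℝ) ^ k * (r / A) ≤ 1 := by
      rw [← mul_div_assoc, div_le_one hA]; exact hk
    have hmin : ((2 : ℝ) ^ k * (r / A)) ^ β ≤
        min (((2 : ℝ) ^ k * (r / A)) ^ β) (((2 : ℝ) ^ k * (r / A)) ^ (-1 : ℝ)) := by
      refine le_min le_rfl ((Real.rpow_le_one (by positivity) hτ hβ.le).trans ?_)
      exact Real.one_le_rpow_of_pos_of_le_one_of_nonpos (by positivity) hτ (by norm_num)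
    refine le_trans (le_of_eq ?_) (mul_le_mul_of_nonneg_right hmin (by positivity))
    rw [Real.mul_rpow ht.le (by positivity), Real.div_rpow hr.le hA.le, Real.rpow_neg hr.le]
    field_simp
  · rw [zero_mul]; exact zero_le

/-- The least of the scaled powers `2 ^ (k s i p i) a ^ p i`. -/
noncomputable def scaleEnergy (s p : ι → ℝ) (k : ℤ) (a : ℝ) : ℝ≥0∞ :=
  ⨅ i, ENNReal.ofReal (((2 : ℝ) ^ k) ^ (s i * p i) * a ^ p i)

@[fun_prop]
theorem Measurable.scaleEnergy {X : Type*} [MeasurableSpace X] {f : X → ℤ} {g : X → ℝ}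
    (s p : ι → ℝ) (hf : Measurable f) (hg : Measurable g) :
    Measurable fun x => _root_.scaleEnergy s p (f x) (g x) := by
  unfold _root_.scaleEnergy
  fun_prop

/-- Summing the scaled energies of `u z.1 - u z.2` over the dyadic scales above `|z.1 - z.2|`. -/
theorem exists_lintegral_scaleEnergy_le {s p : ι → ℝ} (hs : ∀ i, 0 < s i) (hp : ∀ i, 1 ≤ p i)
    {A : ℝ} (hA : 0 < A) :
    ∃ C : ℝ≥0, ∀ u : E → ℝ, Measurable u →
      ∫⁻ a : ℤ × E × E, closeInd A a * (ENNReal.ofReal (((2 : ℝ) ^ a.1) ^ (dim : ℝ)) *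
          scaleEnergy s p a.1 |u a.2.1 - u a.2.2|) ∂(Measure.count.prod (μ.prod μ))
        ≤ C * ∫⁻ z : E × E, ⨅ i, ENNReal.ofReal
          (|u z.1 - u z.2| ^ p i / ‖z.1 - z.2‖ ^ ((dim : ℝ) + s i * p i)) ∂(μ.prod μ) := by
  have hβ : ∀ i, 0 < (dim : ℝ) + s i * p i := fun i => by
    have := mul_pos (hs i) (zero_lt_one.trans_le (hp i)); positivity
  choose C hC using fun i => exists_tsum_zpow_rpow_le hA (hβ i)
  -- The summand `1` makes the constant nonzero, so that it passes through the infimum.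
  refine ⟨∑ i, C i + 1, fun u hu => ?_⟩
  rw [lintegral_prod_symm' _ (by fun_prop), ← lintegral_const_mul _ (by fun_prop)]
  refine lintegral_mono fun z => ?_
  simp only [lintegral_count]
  rw [ENNReal.mul_iInf_of_ne (by simp) ENNReal.coe_ne_top]
  refine le_iInf fun i => ?_
  have hp0 : 0 < p i := zero_lt_one.trans_le (hp i)
  have hle : ∀ k : ℤ, closeInd A (k, z) * (ENNReal.ofReal (((2 : ℝ) ^ k) ^ (dim : ℝ)) *
      scaleEnergy s p k |u z.1 - u z.2|) ≤ (if (2 : ℝ) ^ k * ‖z.1 - z.2‖ ≤ A then 1 else 0) *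
        ENNReal.ofReal (((2 : ℝ) ^ k) ^ ((dim : ℝ) + s i * p i)) *
          ENNReal.ofReal (|u z.1 - u z.2| ^ p i) := by
    intro k
    rw [closeInd, mul_assoc]
    refine mul_le_mul_right ?_ _
    refine (mul_le_mul_right (show scaleEnergy s p k |u z.1 - u z.2| ≤ _ from iInf_le _ i) _).trans_eq ?_
    rw [Real.rpow_add (by positivity), ENNReal.ofReal_mul (by positivity),
      ENNReal.ofReal_mul (by positivity), mul_assoc]
  refine (ENNReal.tsum_le_tsum hle).trans ?_
  rw [ENNReal.tsum_mul_right]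
  rcases (norm_nonneg (z.1 - z.2)).eq_or_lt with h | h
  · have hz : z.1 = z.2 := sub_eq_zero.1 (norm_eq_zero.1 h.symm)
    simp [hz, Real.zero_rpow hp0.ne']
  · refine (mul_le_mul_left (hC i _ h) _).trans ?_
    rw [mul_assoc, ← ENNReal.ofReal_mul (by positivity), mul_comm (_ ^ (-_)), Real.rpow_neg h.le,
      ← div_eq_mul_inv]
    gcongr
    exact (Finset.single_le_sum (f := C) (fun _ _ => zero_le) (Finset.mem_univ i)).trans
      le_self_add

/-! ### Local integrability from finite energy. -/

/-- Either `2 ^ k * a ≤ η`, or the ratio to `η` exceeds `1` and can be raised to the power `p i`. As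
`2 ^ k` and `η` are at most `1`, the exponents `s i * p i` and `1 - P` only weaken the bound, which
thus holds for all `i` at once. -/
theorem mul_le_add_scaleEnergy {s p : ι → ℝ} {P : ℝ} (hs : ∀ i, s i < 1) (hp : ∀ i, 1 ≤ p i)
    (hP : ∀ i, p i ≤ P) {k : ℤ} (hk : k ≤ 0) {η a : ℝ} (hη : 0 < η) (hη1 : η ≤ 1) (ha : 0 ≤ a) :
    ENNReal.ofReal (2 ^ k * a) ≤
      ENNReal.ofReal η + ENNReal.ofReal (η ^ (1 - P)) * scaleEnergy s p k a := by
  rw [scaleEnergy, ENNReal.mul_iInf_of_ne (by simp; positivity) ENNReal.ofReal_ne_top,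
    ENNReal.add_iInf]
  refine le_iInf fun i => ?_
  have ht : (0 : ℝ) < 2 ^ k := by positivity
  have ht1 : (2 : ℝ) ^ k ≤ 1 := zpow_le_one_of_nonpos₀ one_le_two hk
  have hp0 : 0 < p i := zero_lt_one.trans_le (hp i)
  rw [← ENNReal.ofReal_mul (by positivity), ← ENNReal.ofReal_add hη.le (by positivity)]
  refine ENNReal.ofReal_le_ofReal ?_
  rcases le_total (2 ^ k * a) η with h | h
  · exact h.trans (le_add_of_nonneg_right (by positivity))
  · refine le_add_of_nonneg_of_le hη.le ?_
    have h1 : 1 ≤ 2 ^ k * a / η := (one_le_div hη).2 h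
    calc 2 ^ k * a = η * (2 ^ k * a / η) ^ (1 : ℝ) := by rw [Real.rpow_one]; field_simp
      _ ≤ η * (2 ^ k * a / η) ^ p i := by gcongr; exact hp i
      _ = η ^ (1 - p i) * ((2 ^ k) ^ p i * a ^ p i) := by
        rw [Real.div_rpow (by positivity) hη.le, Real.mul_rpow ht.le ha, Real.rpow_sub hη,
          Real.rpow_one]
        field_simp
      _ ≤ η ^ (1 - P) * ((2 ^ k) ^ (s i * p i) * a ^ p i) := by
        gcongr ?_ * (?_ * _)
        · exact Real.rpow_le_rpow_of_exponent_ge hη hη1 (by linarith [hP i])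
        · exact Real.rpow_le_rpow_of_exponent_ge ht ht1 (by nlinarith [hs i])

theorem lintegral_enorm_sub_closedBall_le {s p : ι → ℝ} {P : ℝ} (hs : ∀ i, s i < 1)
    (hp : ∀ i, 1 ≤ p i) (hP : ∀ i, p i ≤ P) (hP0 : 0 < P) {u : E → ℝ} (hu : Measurable u) {M : ℝ≥0∞}
    (hM : ∫⁻ a : ℤ × E × E, closeInd 4 a * (ENNReal.ofReal (((2 : ℝ) ^ a.1) ^ (dim : ℝ)) *
          scaleEnergy s p a.1 |u a.2.1 - u a.2.2|) ∂(Measure.count.prod (μ.prod μ)) ≤ M)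
    {k : ℤ} (hk : k ≤ 0) (x : E) :
    ENNReal.ofReal (2 ^ k) * ∫⁻ w in Metric.closedBall x (2 / 2 ^ k),
        ∫⁻ z in Metric.closedBall x (2 / 2 ^ k), ‖u z - u w‖ₑ ∂μ ∂μ
      ≤ ENNReal.ofReal (((2 : ℝ) ^ k) ^ ((dim : ℝ) / P - 2 * dim)) *
        (ENNReal.ofReal (4 ^ dim) * μ (Metric.ball 0 1) ^ 2 + M) := by
  have ht : (0 : ℝ) < 2 ^ k := by positivity
  have ht1 : (2 : ℝ) ^ k ≤ 1 := zpow_le_one_of_nonpos₀ one_le_two hk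
  set t : ℝ := 2 ^ k with htdef
  set D := Metric.closedBall x (2 / t) with hD
  have hDm : MeasurableSet D := Metric.isClosed_closedBall.measurableSet
  -- This choice balances the two terms: both become multiples of `t ^ (dim / P - 2 * dim)`.
  set η : ℝ := t ^ ((dim : ℝ) / P) with hη
  have hη0 : 0 < η := by positivity
  have hη1 : η ≤ 1 := Real.rpow_le_one ht.le ht1 (by positivity)
  have hMk : ∫⁻ z : E × E, closeInd 4 (k, z) * scaleEnergy s p k |u z.1 - u z.2| ∂(μ.prod μ)
      ≤ ENNReal.ofReal (t ^ (-(dim : ℝ))) * M := by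
    rw [lintegral_prod _ (by fun_prop), lintegral_count] at hM
    have h1 := (ENNReal.le_tsum k).trans hM
    simp only at h1
    have e : ∀ z : E × E, closeInd 4 (k, z) * (ENNReal.ofReal (t ^ (dim : ℝ)) *
        scaleEnergy s p k |u z.1 - u z.2|) = ENNReal.ofReal (t ^ (dim : ℝ)) *
        (closeInd 4 (k, z) * scaleEnergy s p k |u z.1 - u z.2|) := fun z => by ring
    simp only [← htdef, e] at h1
    rw [lintegral_const_mul _ (by fun_prop)] at h1
    refine le_trans (le_of_eq ?_) (mul_le_mul_right h1 _)
    rw [← mul_assoc, ← ENNReal.ofReal_mul (by positivity), ← Real.rpow_add ht]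
    simp
  have hDμ : μ D = ENNReal.ofReal (2 ^ dim * (t ^ dim)⁻¹) * μ (Metric.ball 0 1) :=
    addHaar_closedBall_div μ x zero_le_two ht
  calc ENNReal.ofReal t * ∫⁻ w in D, ∫⁻ z in D, ‖u z - u w‖ₑ ∂μ ∂μ
      = ∫⁻ z in D ×ˢ D, ENNReal.ofReal (t * |u z.1 - u z.2|) ∂(μ.prod μ) := by
        rw [← Measure.prod_restrict, lintegral_prod _ (by fun_prop),
          ← lintegral_const_mul _ (by fun_prop)]
        refine lintegral_congr fun w => ?_
        rw [← lintegral_const_mul _ (by fun_prop)]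
        refine lintegral_congr fun z => ?_
        rw [ENNReal.ofReal_mul ht.le, Real.enorm_eq_ofReal_abs, abs_sub_comm]
    _ ≤ ∫⁻ z in D ×ˢ D, (ENNReal.ofReal η + ENNReal.ofReal (η ^ (1 - P)) *
          (closeInd 4 (k, z) * scaleEnergy s p k |u z.1 - u z.2|)) ∂(μ.prod μ) := by
        refine setLIntegral_mono' (hDm.prod hDm) fun z hz => ?_
        have hc : closeInd 4 (k, z) = 1 := by
          rw [closeInd, if_pos]
          have h1 := (mul_norm_sub_le_iff ht).2 hz.1
          have h2 := (mul_norm_sub_le_iff ht).2 hz.2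
          have := norm_sub_le (x - z.2) (x - z.1)
          rw [sub_sub_sub_cancel_left] at this
          simp only [← htdef]
          nlinarith
        rw [hc, one_mul]
        exact mul_le_add_scaleEnergy hs hp hP hk hη0 hη1 (abs_nonneg _)
    _ ≤ ENNReal.ofReal η * (μ D) ^ 2 + ENNReal.ofReal (η ^ (1 - P)) *
          (ENNReal.ofReal (t ^ (-(dim : ℝ))) * M) := by
        rw [lintegral_add_left measurable_const, setLIntegral_const, Measure.prod_prod, ← sq,
          lintegral_const_mul _ (by fun_prop)]
        gcongr
        exact (setLIntegral_le_lintegral _ _).trans hMk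
    _ = _ := by
        have e1 : η * (2 ^ dim * (t ^ dim)⁻¹) ^ 2
            = t ^ ((dim : ℝ) / P - 2 * dim) * 4 ^ dim := by
          rw [Real.rpow_sub ht, show (2 : ℝ) * dim = ((2 * dim : ℕ) : ℝ) by push_cast; ring,
            Real.rpow_natCast, mul_pow, inv_pow, ← pow_mul, ← pow_mul, mul_comm dim 2,
            pow_mul 2 2]
          norm_num
          field_simp
          exact hη
        have e2 : η ^ (1 - P) * t ^ (-(dim : ℝ)) = t ^ ((dim : ℝ) / P - 2 * dim) := by
          rw [hη, ← Real.rpow_mul ht.le, ← Real.rpow_add ht]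
          congr 1
          field_simp
          ring
        rw [hDμ, mul_pow, ← ENNReal.ofReal_pow (by positivity), ← mul_assoc, ← mul_assoc,
          ← ENNReal.ofReal_mul hη0.le, ← ENNReal.ofReal_mul (by positivity), e1, e2,
          ENNReal.ofReal_mul (by positivity), mul_add, mul_assoc]

/-- The double integral of `|u z - u w|` over a ball is finite at scale `k = 0`, so some `w` makes
`u - u w` integrable there. -/
theorem locallyIntegrable_of_lintegral_scaleEnergy {s p : ι → ℝ} (hs : ∀ i, s i < 1)
    (hp : ∀ i, 1 ≤ p i) {u : E → ℝ} (hu : Measurable u)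
    (hM : ∫⁻ a : ℤ × E × E, closeInd 4 a * (ENNReal.ofReal (((2 : ℝ) ^ a.1) ^ (dim : ℝ)) *
          scaleEnergy s p a.1 |u a.2.1 - u a.2.2|) ∂(Measure.count.prod (μ.prod μ)) ≠ ∞) :
    LocallyIntegrable u μ := by
  intro x
  refine ⟨Metric.closedBall x 2, Metric.closedBall_mem_nhds x two_pos, ?_⟩
  obtain ⟨P, hP⟩ := (Set.finite_range p).bddAbove
  have hP' : ∀ i, p i ≤ P := fun i => hP ⟨i, rfl⟩
  obtain ⟨i⟩ := ‹Nonempty ι›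
  have hP0 : 0 < P := zero_lt_one.trans_le ((hp i).trans (hP' i))
  have h := lintegral_enorm_sub_closedBall_le μ hs hp hP' hP0 hu le_rfl le_rfl x
  simp only [zpow_zero, div_one, ENNReal.ofReal_one, one_mul, Real.one_rpow] at h
  have hfin : ∫⁻ w in Metric.closedBall x 2, ∫⁻ z in Metric.closedBall x 2, ‖u z - u w‖ₑ ∂μ ∂μ
      ≠ ∞ := by
    refine ne_top_of_le_ne_top (ENNReal.add_ne_top.2 ⟨?_, hM⟩) h
    exact ENNReal.mul_ne_top ENNReal.ofReal_ne_top (ENNReal.pow_ne_top measure_ball_lt_top.ne)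
  have hae := ae_lt_top (by fun_prop) hfin
  have hne : NeZero (μ.restrict (Metric.closedBall x 2)) := ⟨by
    rw [Ne, Measure.restrict_eq_zero]
    exact (Metric.measure_closedBall_pos μ x two_pos).ne'⟩
  obtain ⟨w, hw⟩ := hae.exists
  have h1 : IntegrableOn (fun z => u z - u w) (Metric.closedBall x 2) μ :=
    ⟨by fun_prop, hw⟩
  have h2 : IntegrableOn (fun _ => u w) (Metric.closedBall x 2) μ :=
    integrableOn_const measure_closedBall_lt_top.ne
  exact (h1.add h2).congr (ae_of_all _ fun z => by simp)

/-! ### Mollification at coarse and fine scales. -/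

/-- Convolution of `u` with the tent kernel at scale `2 ^ (-k)`. -/
noncomputable def mollify (u : E → ℝ) (k : ℤ) (x : E) : ℝ :=
  ∫ z, tentKernel μ (2 ^ k) (x - z) * u z ∂μ

variable {μ}

theorem mollify_sub_const {u : E → ℝ} (hu : LocallyIntegrable u μ) (k : ℤ) (x : E) (b : ℝ) :
    ∫ z, tentKernel μ (2 ^ k) (x - z) * (u z - b) ∂μ = mollify μ u k x - b := by
  have ht : (0 : ℝ) < 2 ^ k := by positivity
  have h1 := integrable_tentKernel_sub_mul ht x hu
  have h2 := integrable_tentKernel_sub_mul ht x (locallyIntegrable_const (μ := μ) b)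
  simp only [mul_sub]
  rw [integral_sub h1 h2, integral_mul_const, integral_tentKernel_sub ht, one_mul, mollify]

/-- Kernels of mass one let a constant `b` be subtracted from `u`; it is later averaged over the
values of `u` on the ball. -/
theorem enorm_mollify_sub_le {u : E → ℝ} (hu : LocallyIntegrable u μ) {k : ℤ} {x y : E}
    (hxy : 2 ^ k * ‖x - y‖ ≤ 1) (b : ℝ) :
    ‖mollify μ u k x - mollify μ u k y‖ₑ ≤
      ENNReal.ofReal ((tentMass μ)⁻¹ * (2 ^ k) ^ (dim + 1) * ‖x - y‖) *
        ∫⁻ z in Metric.closedBall y (2 / 2 ^ k), ‖u z - b‖ₑ ∂μ := by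
  have ht : (0 : ℝ) < 2 ^ k := by positivity
  have hub : LocallyIntegrable (fun z => u z - b) μ := hu.sub (locallyIntegrable_const b)
  have e : mollify μ u k x - mollify μ u k y
      = ∫ z, (tentKernel μ (2 ^ k) (x - z) - tentKernel μ (2 ^ k) (y - z)) * (u z - b) ∂μ := by
    simp only [sub_mul]
    rw [integral_sub (integrable_tentKernel_sub_mul ht x hub)
      (integrable_tentKernel_sub_mul ht y hub), mollify_sub_const hu, mollify_sub_const hu]
    ring
  rw [e]
  refine (enorm_integral_le_lintegral_enorm _).trans ?_
  rw [← lintegral_const_mul' _ _ ENNReal.ofReal_ne_top,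
    ← lintegral_indicator Metric.isClosed_closedBall.measurableSet]
  refine lintegral_mono fun z => ?_
  by_cases hz : z ∈ Metric.closedBall y (2 / 2 ^ k)
  · rw [indicator_of_mem hz, enorm_mul]
    gcongr
    rw [Real.enorm_eq_ofReal_abs]
    refine ENNReal.ofReal_le_ofReal ?_
    simpa using abs_tentKernel_sub_le (μ := μ) ht (x := x - z) (y := y - z)
  · rw [← mul_norm_sub_le_iff ht, not_le] at hz
    rw [tentKernel_eq_zero, tentKernel_eq_zero (by linarith)]
    · simp
    · have := norm_sub_le_norm_sub_add_norm_sub y x z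
      rw [norm_sub_rev y x] at this
      nlinarith

/-- Averaging the previous bound over `b = u w` gives the rate `(2 ^ k) ^ (dim / P)`, which vanishes
as `k → -∞` since `dim > 0`. -/
theorem tendsto_mollify_sub_zero [Nontrivial E] {s p : ι → ℝ} (hs : ∀ i, s i < 1)
    (hp : ∀ i, 1 ≤ p i) {u : E → ℝ} (hu : Measurable u)
    (hM : ∫⁻ a : ℤ × E × E, closeInd 4 a * (ENNReal.ofReal (((2 : ℝ) ^ a.1) ^ (dim : ℝ)) *
          scaleEnergy s p a.1 |u a.2.1 - u a.2.2|) ∂(Measure.count.prod (μ.prod μ)) ≠ ∞) (x y : E) :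
    Tendsto (fun N : ℕ => mollify μ u (-N) x - mollify μ u (-N) y) atTop (𝓝 0) := by
  have hul := locallyIntegrable_of_lintegral_scaleEnergy μ hs hp hu hM
  obtain ⟨P, hP⟩ := (Set.finite_range p).bddAbove
  have hP' : ∀ i, p i ≤ P := fun i => hP ⟨i, rfl⟩
  have hP0 : 0 < P := by
    obtain ⟨i⟩ := ‹Nonempty ι›
    exact zero_lt_one.trans_le ((hp i).trans (hP' i))
  set V := μ (Metric.ball (0 : E) 1) with hV
  have hVt : V ≠ ∞ := measure_ball_lt_top.ne
  have hV0 : V ≠ 0 := (Metric.measure_ball_pos μ 0 one_pos).ne'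
  set K := ENNReal.ofReal (4 ^ dim) * V ^ 2 +
    ∫⁻ a : ℤ × E × E, closeInd 4 a * (ENNReal.ofReal (((2 : ℝ) ^ a.1) ^ (dim : ℝ)) *
          scaleEnergy s p a.1 |u a.2.1 - u a.2.2|) ∂(Measure.count.prod (μ.prod μ)) with hK
  have hKt : K ≠ ∞ := ENNReal.add_ne_top.2
    ⟨ENNReal.mul_ne_top ENNReal.ofReal_ne_top (ENNReal.pow_ne_top hVt), hM⟩
  have hdim : 0 < dim := Module.finrank_pos
  have hc := tentMass_pos μ
  have bound : ∀ k : ℤ, k ≤ 0 → (2 : ℝ) ^ k * ‖x - y‖ ≤ 1 →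
      ‖mollify μ u k x - mollify μ u k y‖ₑ ≤ V⁻¹ * K *
        ENNReal.ofReal ((tentMass μ)⁻¹ * ‖x - y‖ * ((2 : ℝ) ^ k) ^ ((dim : ℝ) / P)) := by
    intro k hk hxy
    have ht : (0 : ℝ) < 2 ^ k := by positivity
    set t : ℝ := 2 ^ k with htdef
    set X := ‖mollify μ u k x - mollify μ u k y‖ₑ with hX
    set D := Metric.closedBall y (2 / t) with hD
    have hDμ : μ D = ENNReal.ofReal (2 ^ dim * (t ^ dim)⁻¹) * V :=
      addHaar_closedBall_div μ y zero_le_two ht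
    have h1 : X * μ D ≤ ENNReal.ofReal ((tentMass μ)⁻¹ * t ^ (dim + 1) * ‖x - y‖) *
        ∫⁻ w in D, ∫⁻ z in D, ‖u z - u w‖ₑ ∂μ ∂μ := by
      rw [← lintegral_const_mul _ (by fun_prop), ← setLIntegral_const]
      exact lintegral_mono fun w => enorm_mollify_sub_le hul hxy (u w)
    have h2 : X * μ D ≤ ENNReal.ofReal ((tentMass μ)⁻¹ * t ^ dim * ‖x - y‖) *
        (ENNReal.ofReal (t ^ ((dim : ℝ) / P - 2 * dim)) * K) := by
      refine h1.trans ?_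
      rw [show (tentMass μ)⁻¹ * t ^ (dim + 1) * ‖x - y‖ = (tentMass μ)⁻¹ * t ^ dim * ‖x - y‖ * t by
        ring, ENNReal.ofReal_mul (by positivity), mul_assoc]
      exact mul_le_mul_right (lintegral_enorm_sub_closedBall_le μ hs hp hP' hP0 hu le_rfl hk y) _
    have h3 : V * X ≤ ENNReal.ofReal (t ^ dim) * (X * μ D) := by
      rw [hDμ]
      calc V * X = 1 * (V * X) := (one_mul _).symm
        _ ≤ ENNReal.ofReal (t ^ dim * (2 ^ dim * (t ^ dim)⁻¹)) * (V * X) := by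
          gcongr
          rw [ENNReal.one_le_ofReal]
          have : (1 : ℝ) ≤ 2 ^ dim := one_le_pow₀ one_le_two
          field_simp
          exact this
        _ = _ := by rw [ENNReal.ofReal_mul (by positivity)]; ring
    rw [mul_assoc, ← ENNReal.mul_le_iff_le_inv hV0 hVt]
    refine h3.trans ((mul_le_mul_right h2 _).trans_eq ?_)
    rw [← mul_assoc, ← mul_assoc, ← ENNReal.ofReal_mul (by positivity),
      ← ENNReal.ofReal_mul (by positivity), mul_comm]
    congr 2
    rw [Real.rpow_sub ht, show (2 : ℝ) * dim = ((2 * dim : ℕ) : ℝ) by push_cast; ring,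
            Real.rpow_natCast, two_mul dim, pow_add]
    field_simp
  have hpow : Tendsto (fun N : ℕ => (2 : ℝ) ^ (-(N : ℤ))) atTop (𝓝 0) := by
    have := tendsto_pow_atTop_nhds_zero_of_lt_one (r := (2 : ℝ)⁻¹) (by norm_num) (by norm_num)
    simpa [zpow_neg] using this
  have hev : ∀ᶠ N : ℕ in atTop, (2 : ℝ) ^ (-(N : ℤ)) * ‖x - y‖ ≤ 1 := by
    have h := hpow.mul_const ‖x - y‖
    rw [zero_mul] at h
    exact h.eventually (eventually_le_nhds one_pos)
  have hlim : Tendsto (fun N : ℕ => V⁻¹ * K * ENNReal.ofReal ((tentMass μ)⁻¹ * ‖x - y‖ *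
      ((2 : ℝ) ^ (-(N : ℤ))) ^ ((dim : ℝ) / P))) atTop (𝓝 0) := by
    have hq : 0 < (dim : ℝ) / P := by positivity
    have h1 := (hpow.rpow_const (p := (dim : ℝ) / P) (Or.inr hq.le)).const_mul
      ((tentMass μ)⁻¹ * ‖x - y‖)
    rw [Real.zero_rpow hq.ne', mul_zero] at h1
    have h2 := ENNReal.Tendsto.const_mul (a := V⁻¹ * K) (ENNReal.tendsto_ofReal h1)
      (Or.inr (ENNReal.mul_ne_top (ENNReal.inv_ne_top.2 hV0) hKt))
    simpa using h2
  rw [tendsto_zero_iff_enorm_tendsto_zero]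
  refine tendsto_of_tendsto_of_tendsto_of_le_of_le' tendsto_const_nhds hlim
    (Eventually.of_forall fun _ => zero_le) ?_
  filter_upwards [hev] with N hN
  exact bound _ (by simp) hN

/-- The error is dominated by a fixed multiple of the average of `|u - u x|` on a shrinking ball, so
Lebesgue differentiation applies. -/
theorem ae_tendsto_mollify {u : E → ℝ} (hu : LocallyIntegrable u μ) :
    ∀ᵐ x ∂μ, Tendsto (fun N : ℕ => mollify μ u N x) atTop (𝓝 (u x)) := by
  filter_upwards [IsUnifLocDoublingMeasure.ae_tendsto_average_norm_sub μ hu 1] with x hx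
  have hδ : Tendsto (fun N : ℕ => (1 : ℝ) / 2 ^ (N : ℤ)) atTop (𝓝[>] 0) := by
    refine tendsto_nhdsWithin_iff.2 ⟨?_, Eventually.of_forall fun N => by
      simp only [mem_Ioi]; positivity⟩
    have := tendsto_pow_atTop_nhds_zero_of_lt_one (r := (2 : ℝ)⁻¹) (by norm_num) (by norm_num)
    simpa using this
  have h := hx (fun _ : ℕ => x) _ hδ (Eventually.of_forall fun N =>
    Metric.mem_closedBall_self (by positivity))
  have hc := tentMass_pos μ
  rw [← tendsto_sub_nhds_zero_iff]
  have h' := h.const_mul ((tentMass μ)⁻¹ * μ.real (Metric.ball 0 1))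
  rw [mul_zero] at h'
  refine squeeze_zero_norm (fun N => ?_) h'
  have ht : (0 : ℝ) < 2 ^ (N : ℤ) := by positivity
  set t : ℝ := 2 ^ (N : ℤ) with htdef
  set D := Metric.closedBall x (1 / t) with hD
  have hDμ : μ.real D = (t ^ dim)⁻¹ * μ.real (Metric.ball 0 1) := by
    rw [Measure.real, addHaar_closedBall_div μ x zero_le_one ht, ENNReal.toReal_mul,
      ENNReal.toReal_ofReal (by positivity), one_pow, one_mul, Measure.real]
  have hV : 0 < μ.real (Metric.ball (0 : E) 1) :=
    ENNReal.toReal_pos (Metric.measure_ball_pos μ 0 one_pos).ne' measure_ball_lt_top.ne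
  have hub : LocallyIntegrable (fun z => u z - u x) μ := hu.sub (locallyIntegrable_const (u x))
  have hI : IntegrableOn (fun z => ‖u z - u x‖) D μ :=
    (hub.integrableOn_isCompact (isCompact_closedBall x _)).norm
  rw [← mollify_sub_const hu, setAverage_eq, hDμ, smul_eq_mul]
  calc ‖∫ z, tentKernel μ t (x - z) * (u z - u x) ∂μ‖
      ≤ ∫ z, D.indicator (fun z => (tentMass μ)⁻¹ * t ^ dim * ‖u z - u x‖) z ∂μ := by
        refine norm_integral_le_of_norm_le ?_ (ae_of_all _ fun z => ?_)
        · exact IntegrableOn.integrable_indicator (hI.const_mul _) Metric.isClosed_closedBall.measurableSet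
        · by_cases hz : z ∈ D
          · rw [indicator_of_mem hz, norm_mul, Real.norm_of_nonneg (tentKernel_nonneg ht)]
            gcongr
            exact tentKernel_le ht
          · rw [indicator_of_notMem hz]
            rw [← mul_norm_sub_le_iff ht, not_le] at hz
            rw [tentKernel_eq_zero hz.le, zero_mul, norm_zero]
    _ = _ := by
        rw [integral_indicator Metric.isClosed_closedBall.measurableSet, integral_const_mul]
        field_simp
        rfl

end Energy

/-! ### Selection of indices and the decomposition. -/

/-- Disjointing the sets of minimizers selects the first minimizing index. -/
theorem exists_measurable_argmin {X : Type*} [MeasurableSpace X] {l : ℕ} [Nonempty (Fin l)]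
    {f : Fin l → X → ℝ≥0∞} (hf : ∀ i, Measurable (f i)) :
    ∃ g : X → Fin l, Measurable g ∧ ∀ x, f (g x) x = ⨅ i, f i x := by
  set M : Fin l → Set X := fun i => {x | f i x = ⨅ j, f j x} with hM
  have hMm : ∀ i, MeasurableSet (M i) := fun i =>
    measurableSet_eq_fun (hf i) (Measurable.iInf hf)
  have hcover : ∀ x, ∃ i, x ∈ disjointed M i := fun x => by
    rw [← mem_iUnion, iUnion_disjointed, mem_iUnion]
    exact exists_eq_ciInf_of_finite
  choose g hg using hcover
  refine ⟨g, measurable_to_countable' fun i => ?_, fun x => disjointed_subset M _ (hg x)⟩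
  have : g ⁻¹' {i} = disjointed M i := by
    ext x
    refine ⟨fun h => h ▸ hg x, fun h => ?_⟩
    by_contra hne
    exact (disjoint_disjointed M hne).le_bot ⟨hg x, h⟩
  rw [this]
  exact disjointedRec (fun _ i h => h.diff (hMm i)) (hMm i)

section Decomposition

variable {E : Type*} [NormedAddCommGroup E] [NormedSpace ℝ E] [FiniteDimensional ℝ E]
  [MeasurableSpace E] [BorelSpace E] {μ : Measure E} [μ.IsAddHaarMeasure]

local notation "dim" => Module.finrank ℝ E

/-- Each of the two kernels has mass one, so the unused variable integrates out. -/
theorem integral_atom_mul_sub {u : E → ℝ} (hu : LocallyIntegrable u μ) (k : ℤ) (x : E) :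
    Integrable (fun z : E × E => (u z.1 - u z.2) * atom μ (k, z) x) (μ.prod μ) ∧
      ∫ z : E × E, (u z.1 - u z.2) * atom μ (k, z) x ∂(μ.prod μ)
        = mollify μ u (k + 1) x - mollify μ u k x := by
  have ht : (0 : ℝ) < 2 ^ k := by positivity
  have ht1 : (0 : ℝ) < 2 ^ (k + 1) := by positivity
  have h1 := integrable_tentKernel_sub_mul ht x hu
  have h2 := integrable_tentKernel_sub_mul ht1 x hu
  have h3 := integrable_tentKernel_sub_mul ht x (locallyIntegrable_const (μ := μ) (1 : ℝ))
  have h4 := integrable_tentKernel_sub_mul ht1 x (locallyIntegrable_const (μ := μ) (1 : ℝ))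
  simp only [mul_one] at h3 h4
  have e : (fun z : E × E => (u z.1 - u z.2) * atom μ (k, z) x) = fun z =>
      tentKernel μ (2 ^ (k + 1)) (x - z.1) * u z.1 * tentKernel μ (2 ^ k) (x - z.2) -
      tentKernel μ (2 ^ (k + 1)) (x - z.1) * (tentKernel μ (2 ^ k) (x - z.2) * u z.2) := by
    ext z; rw [atom]; ring
  rw [e]
  refine ⟨(h2.mul_prod h3).sub (h4.mul_prod h1), ?_⟩
  rw [integral_sub (h2.mul_prod h3) (h4.mul_prod h1),
    integral_prod_mul (fun z => tentKernel μ (2 ^ (k + 1)) (x - z) * u z)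
      (fun z => tentKernel μ (2 ^ k) (x - z)),
    integral_prod_mul (fun z => tentKernel μ (2 ^ (k + 1)) (x - z))
      (fun z => tentKernel μ (2 ^ k) (x - z) * u z),
    integral_tentKernel_sub ht, integral_tentKernel_sub ht1, mul_one, one_mul, mollify, mollify]

/-- The sum over `ℤ` telescopes separately over `k ≥ 0` and `k < 0`; integrability over all scales
and pairs supplies the summability. -/
theorem integral_atom_sub_eq {u : E → ℝ} (hu : LocallyIntegrable u μ) {x y : E}
    (hI : Integrable (fun a : ℤ × E × E => (u a.2.1 - u a.2.2) * (atom μ a x - atom μ a y))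
      (Measure.count.prod (μ.prod μ)))
    (hx : Tendsto (fun N : ℕ => mollify μ u N x) atTop (𝓝 (u x)))
    (hy : Tendsto (fun N : ℕ => mollify μ u N y) atTop (𝓝 (u y)))
    (hxy : Tendsto (fun N : ℕ => mollify μ u (-N) x - mollify μ u (-N) y) atTop (𝓝 0)) :
    ∫ a : ℤ × E × E, (u a.2.1 - u a.2.2) * (atom μ a x - atom μ a y)
      ∂(Measure.count.prod (μ.prod μ)) = u x - u y := by
  set A : ℤ → ℝ := fun k => mollify μ u k x - mollify μ u k y with hA
  set h : ℤ → ℝ := fun k => A (k + 1) - A k with hh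
  have hk : ∀ k : ℤ, ∫ z : E × E, (u z.1 - u z.2) * (atom μ (k, z) x - atom μ (k, z) y)
      ∂(μ.prod μ) = h k := fun k => by
    obtain ⟨hx1, hx2⟩ := integral_atom_mul_sub hu k x
    obtain ⟨hy1, hy2⟩ := integral_atom_mul_sub hu k y
    simp only [mul_sub]
    rw [integral_sub hx1 hy1, hx2, hy2]
    simp only [hh, hA]
    ring
  have hcount := hI.integral_prod_left
  simp only [hk] at hcount
  have hsum : Summable h := (integrable_count_iff.1 hcount).of_norm
  rw [integral_prod _ hI]
  simp only [hk]
  rw [integral_countable hcount]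
  simp only [measureReal_def, Measure.count_singleton, ENNReal.toReal_one, one_smul]
  have hs1 : Summable fun n : ℕ => h n := hsum.comp_injective Nat.cast_injective
  have hs2 : Summable fun n : ℕ => h (-(n + 1 : ℤ)) :=
    hsum.comp_injective (i := fun n : ℕ => (-(n + 1 : ℤ))) fun a b hab => by simpa using hab
  have t1 : Tendsto (fun N : ℕ => A N - A 0) atTop (𝓝 (∑' n : ℕ, h n)) := by
    refine hs1.tendsto_sum_tsum_nat.congr fun N => ?_
    have := Finset.sum_range_sub (fun n : ℕ => A n) N
    simpa [hh] using this
  have t2 : Tendsto (fun N : ℕ => A 0 - A (-N)) atTop (𝓝 (∑' n : ℕ, h (-(n + 1 : ℤ)))) := by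
    refine hs2.tendsto_sum_tsum_nat.congr fun N => ?_
    have := Finset.sum_range_sub' (fun n : ℕ => A (-n)) N
    simpa [hh] using this
  have t3 := t1.add t2
  rw [← tsum_of_nat_of_neg_add_one hs1 hs2] at t3
  have t4 := (hx.sub hy).sub hxy
  rw [sub_zero] at t4
  refine tendsto_nhds_unique t3 (t4.congr fun N => ?_)
  simp only [hA]
  ring

theorem gagliardo_eq_enorm {p q a r : ℝ} (hp : 0 ≤ p) (hr : 0 ≤ r) :
    ENNReal.ofReal (|a| ^ p / r ^ q) = ‖a‖ₑ ^ p * ENNReal.ofReal (r ^ (-q)) := by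
  rw [Real.enorm_eq_ofReal_abs, ENNReal.ofReal_rpow_of_nonneg (abs_nonneg a) hp,
    ← ENNReal.ofReal_mul (by positivity), Real.rpow_neg hr, div_eq_mul_inv]

variable (μ) in
/-- A measurable function is a sum of functions whose joint Gagliardo energy is controlled by the
energy of the minimum of the integrands. -/
theorem exists_gagliardo_decomposition [Nontrivial E] {l : ℕ} [Nonempty (Fin l)] {s p : Fin l → ℝ}
    (hs : ∀ i, 0 < s i ∧ s i < 1) (hp : ∀ i, 1 ≤ p i) :
    ∃ C : ℝ≥0, 0 < C ∧ ∀ u : E → ℝ, Measurable u → ∃ v : Fin l → E → ℝ,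
      (∀ i, Measurable (v i)) ∧ (∀ᵐ x ∂μ, u x = ∑ i, v i x) ∧
      ∫⁻ z : E × E, ⨆ i, ENNReal.ofReal
          (|v i z.1 - v i z.2| ^ p i / ‖z.1 - z.2‖ ^ ((dim : ℝ) + s i * p i)) ∂(μ.prod μ)
        ≤ C * ∫⁻ z : E × E, ⨅ i, ENNReal.ofReal
          (|u z.1 - u z.2| ^ p i / ‖z.1 - z.2‖ ^ ((dim : ℝ) + s i * p i)) ∂(μ.prod μ) := by
  have hp0 : ∀ i, 0 < p i := fun i => zero_lt_one.trans_le (hp i)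
  obtain ⟨C₄, hC₄⟩ := exists_lintegral_scaleEnergy_le μ (fun i => (hs i).1) hp four_pos
  choose C₁ hC₁ using fun i => exists_lintegral_atom_rpow_le μ (hs i).1 (hs i).2 (hp i)
  -- The summand `1` ensures positivity, also needed for the product with `∞` below.
  refine ⟨(∑ i, C₁ i) * C₄ + 1, by positivity, fun u hu => ?_⟩
  have hM4 := hC₄ u hu
  set M := ∫⁻ z : E × E, ⨅ i, ENNReal.ofReal
    (|u z.1 - u z.2| ^ p i / ‖z.1 - z.2‖ ^ ((dim : ℝ) + s i * p i)) ∂(μ.prod μ) with hMdef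
  have i₀ : Fin l := Classical.arbitrary _
  by_cases hM : M = ∞
  · refine ⟨Pi.single i₀ u, fun i => ?_, ae_of_all _ fun x => ?_, ?_⟩
    · by_cases hi : i = i₀
      · subst hi; simpa using hu
      · rw [Pi.single_eq_of_ne hi]; exact measurable_zero
    · rw [Finset.sum_eq_single i₀ (fun j _ hj => by simp [hj]) (by simp), Pi.single_eq_same]
    · rw [hM, ENNReal.mul_top (by simp)]
      exact le_top
  have hM4t : (C₄ : ℝ≥0∞) * M ≠ ∞ := ENNReal.mul_ne_top ENNReal.coe_ne_top hM
  have hfin := ne_top_of_le_ne_top hM4t hM4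
  have hul := locallyIntegrable_of_lintegral_scaleEnergy μ (fun i => (hs i).2) hp hu hfin
  set ν : Measure (ℤ × E × E) := Measure.count.prod (μ.prod μ) with hν
  obtain ⟨g, hg, hgmin⟩ := exists_measurable_argmin (X := ℤ × E × E) (f := fun i a =>
    ENNReal.ofReal (((2 : ℝ) ^ a.1) ^ (s i * p i) * |u a.2.1 - u a.2.2| ^ p i))
    (fun i => by fun_prop)
  set c : Fin l → ℤ × E × E → ℝ := fun i a => if g a = i then u a.2.1 - u a.2.2 else 0 with hc
  have hcm : ∀ i, Measurable (c i) := fun i =>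
    Measurable.ite (hg (measurableSet_singleton i)) (by fun_prop) measurable_const
  have hcsum : ∀ a, ∑ i, c i a = u a.2.1 - u a.2.2 := fun a => by simp [hc]
  set F : Fin l → E × E → ℝ≥0∞ := fun i w =>
    ∫⁻ a, ‖c i a‖ₑ * ‖atom μ a w.1 - atom μ a w.2‖ₑ ∂ν with hF
  have hFm : ∀ i, Measurable (F i) := fun i => by
    have : Measurable (Function.uncurry fun (w : E × E) (a : ℤ × E × E) =>
        ‖c i a‖ₑ * ‖atom μ a w.1 - atom μ a w.2‖ₑ) := by
      have := hcm i
      simp only [Function.uncurry_def]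
      fun_prop
    exact this.lintegral_prod_right
  set G : Fin l → E × E → ℝ≥0∞ := fun i w =>
    F i w ^ p i * ENNReal.ofReal (‖w.1 - w.2‖ ^ (-((dim : ℝ) + s i * p i))) with hG
  have hGm : ∀ i, Measurable (G i) := fun i => by
    have := hFm i
    simp only [hG]
    fun_prop
  have hGint : ∀ i, ∫⁻ w, G i w ∂(μ.prod μ) ≤ C₁ i * (C₄ * M) := fun i => by
    refine (hC₁ i (fun a => ‖c i a‖ₑ) (hcm i).enorm).trans (mul_le_mul_right (le_trans ?_ hM4) _)
    refine lintegral_mono fun a => ?_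
    -- Atoms need only the radius `2`; the radius `4` comes from pairs in a ball of radius `2 / 2 ^
    -- k`, and one finite quantity serves both.
    have hcl : closeInd 2 a ≤ closeInd 4 a := by
      unfold closeInd
      split_ifs with h1 h2
      · exact le_rfl
      · exact absurd (h1.trans (by norm_num)) h2
      all_goals exact zero_le
    refine mul_le_mul' hcl ?_
    by_cases hga : g a = i
    · refine le_of_eq ?_
      simp only [hc, if_pos hga]
      rw [scaleEnergy, ← hgmin a, hga, Real.enorm_eq_ofReal_abs,
        ENNReal.ofReal_rpow_of_nonneg (abs_nonneg _) (hp0 i).le, Real.rpow_add (by positivity),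
        ENNReal.ofReal_mul (by positivity), ENNReal.ofReal_mul (by positivity), mul_assoc]
    · simp [hc, if_neg hga, hp0 i]
  have hGfin : ∀ᵐ w ∂(μ.prod μ), ∀ i, G i w < ∞ := ae_all_iff.2 fun i =>
    ae_lt_top (hGm i) (ne_top_of_le_ne_top (ENNReal.mul_ne_top ENNReal.coe_ne_top hM4t) (hGint i))
  have hLeb := ae_tendsto_mollify hul
  -- By Fubini, almost every `x₀` has finite `G i (x₀, x)` for almost every `x`; one that is also a
  -- convergence point of the mollifications becomes the base point.
  obtain ⟨x₀, hx₀G, hx₀⟩ := ((Measure.ae_ae_of_ae_prod hGfin).and hLeb).exists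
  have hne : ∀ᵐ x ∂μ, x ≠ x₀ := by simp [ae_iff]
  have hint : ∀ᵐ x ∂μ, ∀ i, Integrable (fun a => c i a * (atom μ a x - atom μ a x₀)) ν := by
    filter_upwards [hx₀G, hne] with x hx hxne i
    have := hcm i
    refine ⟨by fun_prop, ?_⟩
    have hr : ENNReal.ofReal (‖x₀ - x‖ ^ (-((dim : ℝ) + s i * p i))) ≠ 0 := by
      have : 0 < ‖x₀ - x‖ := norm_pos_iff.2 (sub_ne_zero.2 hxne.symm)
      simp only [ne_eq, ENNReal.ofReal_eq_zero, not_le]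
      positivity
    have hFlt : F i (x₀, x) < ∞ := by
      by_contra htop
      rw [not_lt_top_iff] at htop
      have := hx i
      simp only [hG] at this
      rw [htop, ENNReal.top_rpow_of_pos (hp0 i), ENNReal.top_mul hr] at this
      exact this.ne rfl
    rw [HasFiniteIntegral]
    refine lt_of_eq_of_lt (lintegral_congr fun a => ?_) hFlt
    rw [enorm_mul, enorm_sub_rev]
  -- Subtracting the values at `x₀` makes the integrals converge and cancels in differences; the
  -- lost constant `u x₀` is put into the single component `i₀`.
  refine ⟨fun i x => ∫ a, c i a * (atom μ a x - atom μ a x₀) ∂ν + if i = i₀ then u x₀ else 0,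
    fun i => ?_, ?_, ?_⟩
  · have hm : Measurable (Function.uncurry fun (x : E) (a : ℤ × E × E) =>
        c i a * (atom μ a x - atom μ a x₀)) := by
      have := hcm i
      simp only [Function.uncurry_def]
      fun_prop
    exact hm.stronglyMeasurable.integral_prod_right.measurable.add_const _
  · filter_upwards [hint, hLeb] with x hxi hx
    have hsum : ∀ a, ∑ i, c i a * (atom μ a x - atom μ a x₀)
        = (u a.2.1 - u a.2.2) * (atom μ a x - atom μ a x₀) := fun a => by
      rw [← Finset.sum_mul, hcsum]
    have hI := integrable_finsetSum Finset.univ fun i _ => hxi i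
    simp only [hsum] at hI
    rw [Finset.sum_add_distrib, ← integral_finsetSum _ fun i _ => hxi i]
    simp only [hsum]
    rw [integral_atom_sub_eq hul hI hx hx₀
      (tendsto_mollify_sub_zero (fun i => (hs i).2) hp hu hfin x x₀)]
    simp
  · have hprod : ∀ᵐ w ∂(μ.prod μ),
        (∀ i, Integrable (fun a => c i a * (atom μ a w.1 - atom μ a x₀)) ν) ∧
        ∀ i, Integrable (fun a => c i a * (atom μ a w.2 - atom μ a x₀)) ν :=
      (Measure.quasiMeasurePreserving_fst.ae hint).and (Measure.quasiMeasurePreserving_snd.ae hint)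
    calc _ ≤ ∫⁻ w, ∑ i, G i w ∂(μ.prod μ) := by
          refine lintegral_mono_ae ?_
          filter_upwards [hprod] with w hw
          refine iSup_le fun i => le_trans ?_
            (Finset.single_le_sum (f := fun i => G i w) (fun _ _ => zero_le) (Finset.mem_univ i))
          rw [gagliardo_eq_enorm (hp0 i).le (norm_nonneg _)]
          refine mul_le_mul_left (ENNReal.rpow_le_rpow ?_ (hp0 i).le) _
          rw [add_sub_add_right_eq_sub, ← integral_sub (hw.1 i) (hw.2 i)]
          refine (enorm_integral_le_lintegral_enorm _).trans (lintegral_mono fun a => ?_)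
          rw [← mul_sub, sub_sub_sub_cancel_right, enorm_mul]
      _ = ∑ i, ∫⁻ w, G i w ∂(μ.prod μ) := lintegral_finsetSum _ fun i _ => hGm i
      _ ≤ ∑ i, C₁ i * (C₄ * M) := Finset.sum_le_sum fun i _ => hGint i
      _ = ((∑ i, C₁ i) * C₄ : ℝ≥0) * M := by
          rw [← Finset.sum_mul]; push_cast; ring
      _ ≤ _ := by gcongr; exact le_self_add

end Decomposition

/-! ### The Euclidean statement. -/

theorem proposition3p1 (n : ℕ) (hn : 1 ≤ n) (l : ℕ) (hl : 1 ≤ l) (s p : Fin l → ℝ)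
    (hs : ∀ i, 0 < s i ∧ s i < 1) (hp : ∀ i, 1 ≤ p i) :
    ∃ C : ℝ≥0, 0 < C ∧
      ∀ u : EuclideanSpace ℝ (Fin n) → ℝ, AEMeasurable u volume →
        ∃ v : Fin l → EuclideanSpace ℝ (Fin n) → ℝ,
          (∀ i, Measurable (v i)) ∧
          (∀ᵐ x ∂volume, u x = ∑ i, v i x) ∧
          ∫⁻ z : EuclideanSpace ℝ (Fin n) × EuclideanSpace ℝ (Fin n),
              ⨆ i, gagliardoIntegrand (s i) (p i) (v i) z.1 z.2 ∂(volume.prod volume)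
            ≤ (C : ℝ≥0∞) *
              ∫⁻ z : EuclideanSpace ℝ (Fin n) × EuclideanSpace ℝ (Fin n),
                ⨅ i, gagliardoIntegrand (s i) (p i) u z.1 z.2 ∂(volume.prod volume) := by
  have : Nonempty (Fin l) := ⟨⟨0, hl⟩⟩
  have : Nontrivial (EuclideanSpace ℝ (Fin n)) := by
    apply Module.nontrivial_of_finrank_pos (R := ℝ)
    rw [finrank_euclideanSpace_fin]
    exact hn
  obtain ⟨C, hC0, hC⟩ := exists_gagliardo_decomposition
    (volume : Measure (EuclideanSpace ℝ (Fin n))) hs hp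
  simp only [finrank_euclideanSpace_fin] at hC
  refine ⟨C, hC0, fun u hu => ?_⟩
  obtain ⟨v, hvm, hsum, hle⟩ := hC (hu.mk u) hu.measurable_mk
  -- Passing to a measurable representative of `u` changes the integrand only on a null set of
  -- pairs.
  refine ⟨v, hvm, ?_, hle.trans_eq ?_⟩
  · filter_upwards [hsum, hu.ae_eq_mk] with x hx hux
    rw [hux, hx]
  · congr 1
    refine lintegral_congr_ae ?_
    filter_upwards [Measure.quasiMeasurePreserving_fst.ae hu.ae_eq_mk,
      Measure.quasiMeasurePreserving_snd.ae hu.ae_eq_mk] with z h1 h2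
    simp only [gagliardoIntegrand, h1, h2]
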